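/- Let $G=(V,E)$ be a finite graph, possibly with parallel edges but without loops. The line graph $L(G)$ has vertex set $E$, and two distinct edges are adjacent in $L(G)$ if they have an end vertex in common. For integers $p\ge q\ge 1$, a $(p,q)$-coloring of a graph $H$ is a map $f:V(H)\to\{0,1,\dots,p-1\}$ such that $q\le |f(x)-f(y)|\le p-q$ for every edge $xy$ of $H$. The circular chromatic number of $H$ is $\chi_c(H)=\inf\{p/q : p\ge q\ge 1 \text{ integers},\ H \text{ has a } (p,q)\text{-coloring}\}$, and the circular chromatic index of $G$ is $\chi'_c(G)=\chi_c(L(G))$. **Corollary 1.6.** There is no finite loopless graph $G$ (parallel edges allowed) with $11/3<\chi'_c(G)<4$. -/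

import Mathlib

/-- A `(p, q)`-coloring of `G`: a map `f` from the vertices to `{0, 1, …, p - 1}` such that
`q ≤ |f x - f y| ≤ p - q` (computed in the integers) for every edge `xy` of `G`. -/
def IsCircularColoring {V : Type*} (G : SimpleGraph V) (p q : ℕ) (f : V → Fin p) : Prop :=
  ∀ x y : V, G.Adj x y →
    (q : ℤ) ≤ |((f x : ℕ) : ℤ) - ((f y : ℕ) : ℤ)| ∧
      |((f x : ℕ) : ℤ) - ((f y : ℕ) : ℤ)| ≤ (p : ℤ) - (q : ℤ)

/-- The circular chromatic number: the infimum of `p / q` over all pairs of positive integers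
`p ≥ q` such that `G` has a `(p, q)`-coloring. For a finite graph this set is nonempty, and it is
bounded below by `1`. -/
noncomputable def circularChromaticNumber {V : Type*} (G : SimpleGraph V) : ℝ :=
  sInf {r : ℝ | ∃ p q : ℕ, 0 < q ∧ q ≤ p ∧
    (∃ f : V → Fin p, IsCircularColoring G p q f) ∧ r = (p : ℝ) / (q : ℝ)}

/-- The line graph of a multigraph: its vertices are the edges of `G`, and two distinct edges are
adjacent if they have an end vertex in common (so parallel edges are adjacent). -/
def multigraphLineGraph {α β : Type*} (G : Graph α β) : SimpleGraph G.edgeSet where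
  Adj e₁ e₂ := e₁ ≠ e₂ ∧ ∃ x : α, G.Inc e₁ x ∧ G.Inc e₂ x
  symm := ⟨fun _ _ h => ⟨h.1.symm, h.2.imp fun _ hx => hx.symm⟩⟩
  loopless := ⟨fun _ h => h.1 rfl⟩

/-- The circular chromatic index of a multigraph: the circular chromatic number of its line
graph. -/
noncomputable def circularChromaticIndex {α β : Type*} (G : Graph α β) : ℝ :=
  circularChromaticNumber (multigraphLineGraph G)

/-! A circular edge-colouring of ratio below `4` allows no four pairwise adjacent edges, so all
degrees are at most three. It suffices to turn any such colouring into one of ratio `11/3`. Missing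
edges are replaced by semi-edges, which makes the graph cubic (`CubicGraph`); the new colours live
on the circle `ZMod 11`.

Core case: a solid graph with at most one semi-edge. Petersen's theorem gives a perfect matching
containing the semi-edge. Matching edges receive `-1, 0, 1`, and the complementary cycles alternate
`4, 7`, colours far from all three. An even cycle closes up; an odd one can be closed with three
further colours if four consecutive matching labels form an `IsBreak`. In a triangle-free graph such
labels come from an extremal argument (`exists_isBroken`): put a bit at each end of each matching
edge so that every odd cycle reads `s s s' s'` somewhere, with as few disagreements between ends as
possible. Agreeing ends then become `±1`, disagreeing ends `0`.

Triangles are contracted, and colourings lift back. Contraction gets stuck only when two exits of a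
triangle form one edge, and this leads to a Tait colouring (`colourable_or_tait`). Deleting a colour
class of it leaves a `2`-factor whose only possible odd cycle passes through the vertex of the
semi-edge. The labels are then found by hand, except around a triangle or a pentagon with crossing
chords, and these two obstructions are overcome because a colouring of ratio below `4` exists
(`Tait.colourable`).

With two or more semi-edges the graph is doubled along them; across a cut of at most one edge the
two sides are coloured separately and one is rotated (`CircColourable.colourable`). -/

/-! ### Words on the cycles of a permutation, and the extremal argument -/

/-- The word `w`, read along the permutation `σ`, has the form `s s s' s'` with `s ≠ s'` on the four
points starting at `v`. -/
def IsTurn {V : Type*} (σ : Equiv.Perm V) (w : V → Bool) (v : V) : Prop :=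
  w v = w (σ v) ∧ w (σ (σ v)) = w (σ (σ (σ v))) ∧ w v ≠ w (σ (σ v))

/-- Change the value of `y` on the letter `{z, μ z}`. -/
def flipLetter {V : Type*} [DecidableEq V] (μ : V → V) (y : V → Bool) (z : V) : V → Bool :=
  fun w => if w = z ∨ w = μ z then !(y w) else y w

lemma flipLetter_consistent {V : Type*} [DecidableEq V] {μ : V → V} (hμ : ∀ v, μ (μ v) = v)
    {y : V → Bool} (z : V) {w : V} (h : y (μ w) = y w) :
    flipLetter μ y z (μ w) = flipLetter μ y z w := by
  unfold flipLetter
  have h1 : μ w = z ↔ w = μ z := ⟨fun h => by rw [← h, hμ], fun h => by rw [h, hμ]⟩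
  have h2 : μ w = μ z ↔ w = z := ⟨fun h => by rw [← hμ w, h, hμ], fun h => by rw [h]⟩
  simp only [h1, h2, h, or_comm]

lemma flipLetter_of_ne {V : Type*} [DecidableEq V] {μ : V → V} {y : V → Bool} {z w : V}
    (h1 : w ≠ z) (h2 : w ≠ μ z) : flipLetter μ y z w = y w := by
  simp [flipLetter, h1, h2]

lemma flipLetter_self {V : Type*} [DecidableEq V] {μ : V → V} {y : V → Bool} {z : V} :
    flipLetter μ y z z = !(y z) := by
  simp [flipLetter]

/-- A word which is not constant on a cycle can be given a turn there by changing at most one letter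
that leaves the cycle. -/
lemma exists_isTurn_near_of_run {V : Type*} [DecidableEq V] (σ : Equiv.Perm V) {μ : V → V}
    (hμ : ∀ v, μ (μ v) = v) (C : Set V) (hC : ∀ v ∈ C, σ v ∈ C)
    (h1 : ∀ v ∈ C, σ v ≠ v) (h2 : ∀ v ∈ C, σ (σ v) ≠ v) (h3 : ∀ v ∈ C, σ (σ (σ v)) ≠ v)
    (h4 : ∀ v ∈ C, σ (σ (σ (σ v))) ≠ v) (h6 : ∀ v ∈ C, σ (σ (σ (σ (σ (σ v))))) ≠ v)
    (hd : ∀ v ∈ C, μ v ≠ σ (σ v))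
    {y : V → Bool} (hy : ∀ v ∈ C, μ v ∈ C → y (μ v) = y v)
    {v0 v1 v2 v3 v4 v5 v6 : V} (hv0 : v0 ∈ C) (e1 : v1 = σ v0) (e2 : v2 = σ v1) (e3 : v3 = σ v2)
    (e4 : v4 = σ v3) (e5 : v5 = σ v4) (e6 : v6 = σ v5)
    (h34 : y v3 = y v4) (h45 : y v4 ≠ y v5) :
    ∃ w : V → Bool, (∀ v ∈ C, μ v ∈ C → w (μ v) = w v) ∧ (∃ v ∈ C, IsTurn σ w v) ∧
      ∃ z, ∀ v ∈ C, μ v ∉ C → w v ≠ y v → v = z := by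
  have m1 : v1 ∈ C := e1 ▸ hC _ hv0
  have m2 : v2 ∈ C := e2 ▸ hC _ m1
  have m3 : v3 ∈ C := e3 ▸ hC _ m2
  have m4 : v4 ∈ C := e4 ▸ hC _ m3
  have m5 : v5 ∈ C := e5 ▸ hC _ m4
  have m6 : v6 ∈ C := e6 ▸ hC _ m5
  have turn : ∀ {w : V → Bool} {a b c d : V}, b = σ a → c = σ b → d = σ c → w a = w b → w c = w d →
      w a ≠ w c → IsTurn σ w a := by
    rintro w a b c d rfl rfl rfl p q r
    exact ⟨p, q, r⟩
  have cons1 : ∀ z, ∀ v ∈ C, μ v ∈ C → flipLetter μ y z (μ v) = flipLetter μ y z v :=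
    fun z v hv hv' => flipLetter_consistent hμ z (hy v hv hv')
  have out1 : ∀ (x : V → Bool) (z : V), z ∈ C → ∀ v ∈ C, μ v ∉ C → flipLetter μ x z v ≠ x v →
      v = z := by
    intro x z hz v hv hv' hne
    by_contra hvz
    refine hne (flipLetter_of_ne hvz ?_)
    rintro rfl
    exact hv' (by rwa [hμ])
  have inv : ∀ {a b}, μ a = b → μ b = a := by
    rintro a b rfl
    exact hμ a
  have d01 : v1 ≠ v0 := by rw [e1]; exact h1 v0 hv0
  have d12 : v2 ≠ v1 := by rw [e2]; exact h1 v1 m1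
  have d23 : v3 ≠ v2 := by rw [e3]; exact h1 v2 m2
  have d34 : v4 ≠ v3 := by rw [e4]; exact h1 v3 m3
  have d45 : v5 ≠ v4 := by rw [e5]; exact h1 v4 m4
  have d56 : v6 ≠ v5 := by rw [e6]; exact h1 v5 m5
  have d02 : v2 ≠ v0 := by rw [e2, e1]; exact h2 v0 hv0
  have d13 : v3 ≠ v1 := by rw [e3, e2]; exact h2 v1 m1
  have d24 : v4 ≠ v2 := by rw [e4, e3]; exact h2 v2 m2
  have d35 : v5 ≠ v3 := by rw [e5, e4]; exact h2 v3 m3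
  have d46 : v6 ≠ v4 := by rw [e6, e5]; exact h2 v4 m4
  have d03 : v3 ≠ v0 := by rw [e3, e2, e1]; exact h3 v0 hv0
  have d14 : v4 ≠ v1 := by rw [e4, e3, e2]; exact h3 v1 m1
  have d25 : v5 ≠ v2 := by rw [e5, e4, e3]; exact h3 v2 m2
  have d36 : v6 ≠ v3 := by rw [e6, e5, e4]; exact h3 v3 m3
  have d04 : v4 ≠ v0 := by rw [e4, e3, e2, e1]; exact h4 v0 hv0
  have d15 : v5 ≠ v1 := by rw [e5, e4, e3, e2]; exact h4 v1 m1
  have d26 : v6 ≠ v2 := by rw [e6, e5, e4, e3]; exact h4 v2 m2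
  have d06 : v6 ≠ v0 := by rw [e6, e5, e4, e3, e2, e1]; exact h6 v0 hv0
  have t0 : μ v0 ≠ v2 := by rw [e2, e1]; exact hd v0 hv0
  have t1 : μ v1 ≠ v3 := by rw [e3, e2]; exact hd v1 m1
  have t2 : μ v2 ≠ v4 := by rw [e4, e3]; exact hd v2 m2
  have t3 : μ v3 ≠ v5 := by rw [e5, e4]; exact hd v3 m3
  have t4 : μ v4 ≠ v6 := by rw [e6, e5]; exact hd v4 m4
  have yμ : ∀ {a b}, a ∈ C → b ∈ C → y a ≠ y b → μ a ≠ b := by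
    rintro a b ha hb hab rfl
    exact hab (hy a ha hb).symm
  -- The value changes after the run `v3 v4`. A turn is sought by flipping one letter near the run;
  -- the flips at `v6` and `v1` fail only if the letter has its other end inside the turn. The
  -- chords so forced are `v3 v6` and `v1 v4`.
  by_cases h6s : y v6 = y v5
  · exact ⟨y, hy, ⟨v3, m3, turn e4 e5 e6 h34 h6s.symm (h34 ▸ h45)⟩, v3, by simp⟩
  have h46 : y v6 = y v4 := by
    revert h6s h45; cases y v6 <;> cases y v5 <;> cases y v4 <;> simp
  by_cases c63 : μ v6 = v3
  swap
  · have n4 : v4 ≠ μ v6 := fun h => t4 (inv h.symm)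
    have n5 : v5 ≠ μ v6 := (yμ m6 m5 h6s).symm
    refine ⟨flipLetter μ y v6, cons1 v6, ⟨v3, m3, turn e4 e5 e6 ?_ ?_ ?_⟩, v6, out1 y v6 m6⟩
    · rw [flipLetter_of_ne d36.symm (Ne.symm c63), flipLetter_of_ne d46.symm n4, h34]
    · rw [flipLetter_of_ne d56.symm n5, flipLetter_self]
      revert h6s; cases y v6 <;> cases y v5 <;> simp
    · rw [flipLetter_of_ne d36.symm (Ne.symm c63), flipLetter_of_ne d56.symm n5, h34]
      exact h45
  have c36 := inv c63
  by_cases h2s : y v2 = y v3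
  · have n2 : v2 ≠ μ v4 := fun h => t2 (inv h.symm)
    have n3 : v3 ≠ μ v4 := fun h => d46 (by rw [← c36, h, hμ])
    have n5 : v5 ≠ μ v4 := (yμ m4 m5 h45).symm
    refine ⟨flipLetter μ y v4, cons1 v4, ⟨v2, m2, turn e3 e4 e5 ?_ ?_ ?_⟩, v4, out1 y v4 m4⟩
    · rw [flipLetter_of_ne d24.symm n2, flipLetter_of_ne d34.symm n3, h2s]
    · rw [flipLetter_of_ne d45 n5, flipLetter_self]
      revert h45; cases y v4 <;> cases y v5 <;> simp
    · rw [flipLetter_of_ne d24.symm n2, flipLetter_self, h2s, h34]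
      simp
  by_cases h1s : y v1 = y v2
  · exact ⟨y, hy, ⟨v1, m1, turn e2 e3 e4 h1s h34 (h1s ▸ h2s)⟩, v3, by simp⟩
  by_cases c14 : μ v1 = v4
  swap
  · have n2 : v2 ≠ μ v1 := (yμ m1 m2 h1s).symm
    have n3 : v3 ≠ μ v1 := t1.symm
    refine ⟨flipLetter μ y v1, cons1 v1, ⟨v1, m1, turn e2 e3 e4 ?_ ?_ ?_⟩, v1, out1 y v1 m1⟩
    · rw [flipLetter_of_ne d12 n2, flipLetter_self]
      revert h1s; cases y v1 <;> cases y v2 <;> simp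
    · rw [flipLetter_of_ne d13 n3, flipLetter_of_ne d14 (Ne.symm c14), h34]
    · rw [flipLetter_of_ne d13 n3, flipLetter_self]
      revert h1s h2s; cases y v1 <;> cases y v2 <;> cases y v3 <;> simp
  have c41 := inv c14
  have n16 : v1 ≠ v6 := fun h => d34 (by rw [← c14, h, c63])
  have f1 : flipLetter μ y v3 v1 = y v1 := flipLetter_of_ne d13.symm (by rw [c36]; exact n16)
  have f2 : flipLetter μ y v3 v2 = y v2 := flipLetter_of_ne d23.symm (by rw [c36]; exact d26.symm)
  have f0 : flipLetter μ y v3 v0 = y v0 := flipLetter_of_ne d03.symm (by rw [c36]; exact d06.symm)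
  have f3 : flipLetter μ y v3 v3 = !(y v3) := flipLetter_self
  -- The letter of `v3` is now a chord, so flipping it is free and leaves one flip to spend at `v0`.
  have out3 : ∀ v ∈ C, μ v ∉ C → flipLetter μ y v3 v = y v := by
    intro v hv hv'
    by_contra hne
    have := out1 y v3 m3 v hv hv' hne
    subst this
    exact hv' (c36 ▸ m6)
  by_cases h0s : y v0 = y v1
  · refine ⟨flipLetter μ y v3, cons1 v3, ⟨v0, hv0, turn e1 e2 e3 ?_ ?_ ?_⟩, v3, out1 y v3 m3⟩
    · rw [f0, f1, h0s]
    · rw [f2, f3]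
      revert h2s; cases y v2 <;> cases y v3 <;> simp
    · rw [f0, f2, h0s]
      exact h1s
  · have n1 : v1 ≠ μ v0 := fun h => d04 (by rw [← c14, h, hμ])
    have n2 : v2 ≠ μ v0 := t0.symm
    have n3 : v3 ≠ μ v0 := fun h => d06 (by rw [← c36, h, hμ])
    refine ⟨flipLetter μ (flipLetter μ y v3) v0,
      fun v hv hv' => flipLetter_consistent hμ v0 (cons1 v3 v hv hv'),
      ⟨v0, hv0, turn e1 e2 e3 ?_ ?_ ?_⟩, v0, ?_⟩
    · rw [flipLetter_self, flipLetter_of_ne d01 n1, f0, f1]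
      revert h0s; cases y v0 <;> cases y v1 <;> simp
    · rw [flipLetter_of_ne d02 n2, flipLetter_of_ne d03 n3, f2, f3]
      revert h2s; cases y v2 <;> cases y v3 <;> simp
    · rw [flipLetter_self, flipLetter_of_ne d02 n2, f0, f2]
      revert h0s h1s; cases y v0 <;> cases y v1 <;> cases y v2 <;> simp
    · intro v hv hv' hne
      exact out1 (flipLetter μ y v3) v0 hv0 v hv hv' (by rwa [out3 v hv hv'])

open Function in
lemma minimalPeriod_eq_of_sameCycle {V : Type*} [Finite V] {σ : Equiv.Perm V} {v u : V}
    (h : σ.SameCycle v u) : minimalPeriod σ u = minimalPeriod σ v := by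
  obtain ⟨n, rfl⟩ := h.exists_nat_pow_eq
  rw [← Equiv.Perm.iterate_eq_pow]
  exact minimalPeriod_apply_iterate (σ.injective.mem_periodicPts v) n

open Function in
/-- A nonconstant word on an odd cycle repeats a value and then changes it. -/
lemma exists_run_of_odd {V : Type*} [Finite V] {σ : Equiv.Perm V} {v : V}
    (hodd : Odd (minimalPeriod σ v)) {y : V → Bool} (hnc : ∃ u, σ.SameCycle v u ∧ y u ≠ y v) :
    ∃ u, σ.SameCycle v u ∧ y u = y (σ u) ∧ y (σ u) ≠ y (σ (σ u)) := by
  by_contra! hcon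
  by_cases hex : ∃ u, σ.SameCycle v u ∧ y u = y (σ u)
  · obtain ⟨u, hvu, hu⟩ := hex
    have key : ∀ n : ℕ, y (σ^[n] u) = y u ∧ y (σ^[n] u) = y (σ (σ^[n] u)) := by
      intro n
      induction n with
      | zero => exact ⟨rfl, hu⟩
      | succ n ih =>
        have hs : σ.SameCycle v (σ^[n] u) := by
          rw [Equiv.Perm.iterate_eq_pow]
          exact hvu.trans ⟨n, by simp⟩
        rw [iterate_succ_apply']
        exact ⟨ih.2.symm.trans ih.1, hcon _ hs ih.2⟩
    have all : ∀ z, σ.SameCycle v z → y z = y u := by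
      intro z hz
      obtain ⟨n, rfl⟩ := (hvu.symm.trans hz).exists_nat_pow_eq
      rw [← Equiv.Perm.iterate_eq_pow]
      exact (key n).1
    obtain ⟨z, hz, hne⟩ := hnc
    exact hne ((all z hz).trans (all v (Equiv.Perm.SameCycle.refl _ _)).symm)
  · push Not at hex
    have key : ∀ n : ℕ, y (σ^[n] v) = (y v ^^ decide (Odd n)) := by
      intro n
      induction n with
      | zero => simp
      | succ n ih =>
        have hs : σ.SameCycle v (σ^[n] v) := by
          rw [Equiv.Perm.iterate_eq_pow]
          exact ⟨n, by simp⟩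
        have := hex _ hs
        rw [iterate_succ_apply']
        rw [ih] at this
        have h2 : decide (Odd (n + 1)) = !decide (Odd n) := by
          by_cases h : Odd n <;> simp [h, Nat.odd_add_one]
        rw [h2]
        revert this
        cases y (σ (σ^[n] v)) <;> cases y v <;> cases decide (Odd n) <;> simp
    have := key (minimalPeriod σ v)
    rw [iterate_minimalPeriod] at this
    simp [hodd] at this

/-- Compatibility of a matching `μ` with a permutation `σ`: the odd cycles of `σ` have length at
least five, and `μ` does not join two points at distance two on them. -/
structure IsSpread {V : Type*} (σ : Equiv.Perm V) (μ : V → V) : Prop where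
  invol : ∀ v, μ (μ v) = v
  five_le : ∀ v, Odd (Function.minimalPeriod σ v) → 5 ≤ Function.minimalPeriod σ v
  ne_two : ∀ v, Odd (Function.minimalPeriod σ v) → μ v ≠ σ (σ v)

-- An odd length of at least five divides none of `1, 2, 3, 4, 6`. Hence the seven points around the
-- run are distinct, except that `v0 = v5` and `v1 = v6` on a pentagon.
open Function in
lemma exists_isTurn_near {V : Type*} [Finite V] {σ : Equiv.Perm V} {μ : V → V}
    (h : IsSpread σ μ) {v : V} (hodd : Odd (minimalPeriod σ v)) {y : V → Bool}
    (hy : ∀ u, σ.SameCycle v u → σ.SameCycle v (μ u) → y (μ u) = y u)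
    (hnc : ∃ u, σ.SameCycle v u ∧ y u ≠ y v) :
    ∃ w : V → Bool, (∀ u, σ.SameCycle v u → σ.SameCycle v (μ u) → w (μ u) = w u) ∧
      (∃ u, σ.SameCycle v u ∧ IsTurn σ w u) ∧
      ∃ z, ∀ u, σ.SameCycle v u → ¬ σ.SameCycle v (μ u) → w u ≠ y u → u = z := by
  classical
  obtain ⟨u, hvu, hu, hu'⟩ := exists_run_of_odd hodd hnc
  have hper : ∀ z, σ.SameCycle v z → minimalPeriod σ z = minimalPeriod σ v :=
    fun z hz => minimalPeriod_eq_of_sameCycle hz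
  have h5 := h.five_le v hodd
  have hit : ∀ z, σ.SameCycle v z → ∀ n : ℕ, 0 < n → (Odd (minimalPeriod σ v) →
      5 ≤ minimalPeriod σ v → ¬ minimalPeriod σ v ∣ n) → σ^[n] z ≠ z := by
    intro z hz n _ hd heq
    have : IsPeriodicPt σ n z := heq
    exact hd hodd h5 (hper z hz ▸ this.minimalPeriod_dvd)
  have small : ∀ n : ℕ, 0 < n → n < 5 → (Odd (minimalPeriod σ v) →
      5 ≤ minimalPeriod σ v → ¬ minimalPeriod σ v ∣ n) :=
    fun n h0 h1 _ h2 h3 => by have := Nat.le_of_dvd h0 h3; omega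
  have six : Odd (minimalPeriod σ v) → 5 ≤ minimalPeriod σ v → ¬ minimalPeriod σ v ∣ 6 := by
    intro h1 h2 h3
    have h4 := Nat.le_of_dvd (by norm_num) h3
    generalize minimalPeriod σ v = k at *
    interval_cases k
    · omega
    · exact absurd h1 (by decide)
  refine exists_isTurn_near_of_run σ h.invol {z | σ.SameCycle v z}
    (fun z hz => Equiv.Perm.sameCycle_apply_right.2 hz)
    (fun z hz => hit z hz 1 (by norm_num) (small 1 (by norm_num) (by norm_num)))
    (fun z hz => hit z hz 2 (by norm_num) (small 2 (by norm_num) (by norm_num)))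
    (fun z hz => hit z hz 3 (by norm_num) (small 3 (by norm_num) (by norm_num)))
    (fun z hz => hit z hz 4 (by norm_num) (small 4 (by norm_num) (by norm_num)))
    (fun z hz => hit z hz 6 (by norm_num) six)
    (fun z hz => h.ne_two z (by rw [hper z hz]; exact hodd)) hy
    (v0 := σ⁻¹ (σ⁻¹ (σ⁻¹ u))) (v1 := σ⁻¹ (σ⁻¹ u)) (v2 := σ⁻¹ u) (v3 := u) (v4 := σ u)
    (v5 := σ (σ u)) (v6 := σ (σ (σ u))) ?_ (by simp) (by simp) (by simp) rfl rfl rfl hu hu'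
  simpa using hvu

/-- A word is admissible if it has a turn on every odd cycle and agrees on the two ends of every
chord of an odd cycle. -/
def IsAdmissible {V : Type*} (σ : Equiv.Perm V) (μ : V → V) (w : V → Bool) : Prop :=
  ∀ v, Odd (Function.minimalPeriod σ v) → (∃ u, σ.SameCycle v u ∧ IsTurn σ w u) ∧
    (σ.SameCycle v (μ v) → w (μ v) = w v)

lemma IsTurn.congr {V : Type*} {σ : Equiv.Perm V} {w w' : V → Bool} {v u : V}
    (hvu : σ.SameCycle v u) (h : ∀ z, σ.SameCycle v z → w' z = w z) (ht : IsTurn σ w u) :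
    IsTurn σ w' u := by
  have h1 : σ.SameCycle v (σ u) := Equiv.Perm.sameCycle_apply_right.2 hvu
  have h2 : σ.SameCycle v (σ (σ u)) := Equiv.Perm.sameCycle_apply_right.2 h1
  have h3 : σ.SameCycle v (σ (σ (σ u))) := Equiv.Perm.sameCycle_apply_right.2 h2
  unfold IsTurn
  rwa [h _ hvu, h _ h1, h _ h2, h _ h3]

open Function in
lemma exists_isAdmissible {V : Type*} [Finite V] {σ : Equiv.Perm V} {μ : V → V}
    (h : IsSpread σ μ) : ∃ w, IsAdmissible σ μ w := by
  classical
  have H : ∀ v : V, ∃ w : V → Bool, Odd (minimalPeriod σ v) →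
      (∃ u, σ.SameCycle v u ∧ IsTurn σ w u) ∧
      ∀ u, σ.SameCycle v u → σ.SameCycle v (μ u) → w (μ u) = w u := by
    intro v
    by_cases hodd : Odd (minimalPeriod σ v)
    swap
    · exact ⟨fun _ => true, fun h => absurd h hodd⟩
    have h5 := h.five_le v hodd
    have hne : ∀ n : ℕ, 0 < n → n < 5 → σ^[n] v ≠ v := by
      intro n h0 h1 heq
      have : IsPeriodicPt σ n v := heq
      have := Nat.le_of_dvd h0 this.minimalPeriod_dvd
      omega
    have hy : ∀ u, decide (μ u = v ∨ μ u = μ v) = decide (u = v ∨ u = μ v) := by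
      intro u
      have h1 : μ u = v ↔ u = μ v := ⟨fun e => by rw [← e, h.invol], fun e => by rw [e, h.invol]⟩
      have h2 : μ u = μ v ↔ u = v := ⟨fun e => by rw [← h.invol u, e, h.invol], fun e => by rw [e]⟩
      simp only [h1, h2, or_comm]
    obtain ⟨w, h1, h2, -⟩ := exists_isTurn_near h hodd
      -- The indicator of a single letter is not constant on a cycle of length at least five: it
      -- vanishes at `σ v`, or at `σ (σ v)` if `σ v = μ v`.
      (y := fun u => decide (u = v ∨ u = μ v)) (fun u _ _ => hy u) (by
        by_cases hc : σ v = μ v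
        · refine ⟨σ (σ v), by simp [Equiv.Perm.SameCycle.refl], ?_⟩
          have a := hne 2 (by norm_num) (by norm_num)
          have b := hne 1 (by norm_num) (by norm_num)
          simp only [iterate_succ, comp_apply, iterate_zero, id] at a b
          simp [a, ← hc, b]
        · refine ⟨σ v, by simp [Equiv.Perm.SameCycle.refl], ?_⟩
          have b := hne 1 (by norm_num) (by norm_num)
          simp only [iterate_succ, comp_apply, iterate_zero, id] at b
          simp [hc, b])
    exact ⟨w, fun _ => ⟨h2, h1⟩⟩
  choose F hF using H
  let r : V → V := fun v => (Quotient.mk (Equiv.Perm.SameCycle.setoid σ) v).out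
  have hr : ∀ v, σ.SameCycle (r v) v := fun v => Quotient.mk_out (s := Equiv.Perm.SameCycle.setoid σ) v
  have hr' : ∀ {v u}, σ.SameCycle v u → r u = r v := by
    intro v u hvu
    have : Quotient.mk (Equiv.Perm.SameCycle.setoid σ) u = Quotient.mk _ v :=
      Quotient.sound (s := Equiv.Perm.SameCycle.setoid σ) hvu.symm
    simp only [r, this]
  refine ⟨fun v => F (r v) v, fun v hodd => ?_⟩
  have ho : Odd (minimalPeriod σ (r v)) := by
    rwa [← minimalPeriod_eq_of_sameCycle (hr v)]
  obtain ⟨⟨u, hu, ht⟩, h2⟩ := hF (r v) ho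
  refine ⟨⟨u, (hr v).symm.trans hu, ht.congr hu fun z hz => ?_⟩, fun hv => ?_⟩
  · rw [hr' hz]
    have : r (r v) = r v := hr' (hr v).symm
    rw [this]
  · change F (r (μ v)) (μ v) = F (r v) v
    rw [hr' hv]
    exact h2 v (hr v) ((hr v).trans hv)

/-- Replacing an admissible word on one odd cycle. -/
lemma IsAdmissible.replace {V : Type*} [Finite V] {σ : Equiv.Perm V} {μ : V → V}
    {w w' : V → Bool} (hw : IsAdmissible σ μ w) {v : V}
    (h1 : ∀ u, σ.SameCycle v u → σ.SameCycle v (μ u) → w' (μ u) = w' u)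
    (h2 : ∃ u, σ.SameCycle v u ∧ IsTurn σ w' u) :
    ∃ f, IsAdmissible σ μ f ∧ (∀ u, σ.SameCycle v u → f u = w' u) ∧
      ∀ u, ¬ σ.SameCycle v u → f u = w u := by
  classical
  obtain ⟨f, hf⟩ : ∃ f : V → Bool, f = fun u => if σ.SameCycle v u then w' u else w u := ⟨_, rfl⟩
  have f1 : ∀ u, σ.SameCycle v u → f u = w' u := fun u hu => by simp [hf, hu]
  have f2 : ∀ u, ¬ σ.SameCycle v u → f u = w u := fun u hu => by simp [hf, hu]
  refine ⟨f, fun z hz => ?_, f1, f2⟩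
  by_cases hvz : σ.SameCycle v z
  · obtain ⟨u, hu, ht⟩ := h2
    refine ⟨⟨u, hvz.symm.trans hu, ht.congr hu f1⟩, fun hm => ?_⟩
    have := hvz.trans hm
    rw [f1 _ this, f1 _ hvz]
    exact h1 z hvz this
  · obtain ⟨⟨u, hu, ht⟩, h3⟩ := hw z hz
    refine ⟨⟨u, hu, ht.congr hu fun x hx => f2 x fun h => hvz (h.trans hx.symm)⟩, fun hm => ?_⟩
    rw [f2 _ fun h => hvz (h.trans hm.symm), f2 _ hvz]
    exact h3 hm

/-- The number of ends of letters on which a word disagrees with itself. -/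
noncomputable def discord {V : Type*} [Fintype V] (μ : V → V) (w : V → Bool) : ℕ := by
  classical
  exact (Finset.univ.filter fun u => w u ≠ w (μ u)).card

-- A letter crossing the border of `C` is seen from both sides, whence the factor two; letters
-- inside `C` contribute nothing.
open Classical in
lemma discord_eq {V : Type*} [Fintype V] {μ : V → V} (hμ : ∀ v, μ (μ v) = v)
    (C : Set V) (w : V → Bool) (hw : ∀ u ∈ C, μ u ∈ C → w (μ u) = w u) :
    discord μ w = 2 * (Finset.univ.filter fun u => u ∈ C ∧ μ u ∉ C ∧ w u ≠ w (μ u)).card +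
      (Finset.univ.filter fun u => u ∉ C ∧ μ u ∉ C ∧ w u ≠ w (μ u)).card := by
  have e : (Finset.univ.filter fun u => u ∉ C ∧ μ u ∈ C ∧ w u ≠ w (μ u)).card =
      (Finset.univ.filter fun u => u ∈ C ∧ μ u ∉ C ∧ w u ≠ w (μ u)).card := by
    refine Finset.card_bij (fun u _ => μ u) ?_ ?_ ?_
    · intro a ha
      simp only [Finset.mem_filter, Finset.mem_univ, true_and, hμ] at ha ⊢
      exact ⟨ha.2.1, ha.1, ha.2.2.symm⟩
    · intro a _ b _ hab
      rw [← hμ a, hab, hμ]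
    · intro b hb
      simp only [Finset.mem_filter, Finset.mem_univ, true_and] at hb
      refine ⟨μ b, ?_, hμ b⟩
      simp only [Finset.mem_filter, Finset.mem_univ, true_and, hμ]
      exact ⟨hb.2.1, hb.1, hb.2.2.symm⟩
  rw [two_mul]
  nth_rw 1 [← e]
  rw [add_assoc, add_comm, add_assoc, discord]
  rw [← Finset.card_union_of_disjoint, ← Finset.card_union_of_disjoint]
  · congr 1
    ext u
    simp only [Finset.mem_filter, Finset.mem_univ, true_and, Finset.mem_union]
    have := hw u
    tauto
  · rw [Finset.disjoint_left]
    intro u hu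
    simp only [Finset.mem_filter, Finset.mem_univ, true_and, Finset.mem_union] at hu ⊢
    tauto
  · rw [Finset.disjoint_left]
    intro u hu
    simp only [Finset.mem_filter, Finset.mem_univ, true_and] at hu ⊢
    tauto

/-- The four consecutive labels around which a cycle of odd length can be coloured. -/
def IsBreak (a b c d : ℤ) : Prop :=
  (a ≤ 0 ∧ b ≤ 0 ∧ c = 1 ∧ d = 1) ∨ (a = 1 ∧ b = 1 ∧ c ≤ 0 ∧ d ≤ 0) ∨
    (a = -1 ∧ b = -1 ∧ 0 ≤ c ∧ 0 ≤ d) ∨ (0 ≤ a ∧ 0 ≤ b ∧ c = -1 ∧ d = -1)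

/-- A labelling of the letters by `-1, 0, 1` having a break on every odd cycle. -/
structure IsBroken {V : Type*} (σ : Equiv.Perm V) (μ : V → V) (l : V → ℤ) : Prop where
  invol : ∀ v, l (μ v) = l v
  range : ∀ v, l v = -1 ∨ l v = 0 ∨ l v = 1
  break_odd : ∀ v, Odd (Function.minimalPeriod σ v) →
    ∃ u, σ.SameCycle v u ∧ IsBreak (l u) (l (σ u)) (l (σ (σ u))) (l (σ (σ (σ u))))

-- Minimality localised at one cycle: a replacement there leaves all disagreements elsewhere
-- unchanged, so only the letters leaving the cycle are compared, each with the value of `w` at its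
-- outer end.
open Classical in
lemma card_disagree_le {V : Type*} [Fintype V] {σ : Equiv.Perm V} {μ : V → V}
    (hμ : ∀ v, μ (μ v) = v) {w : V → Bool}
    (hw : IsAdmissible σ μ w) (hmin : ∀ w', IsAdmissible σ μ w' → discord μ w ≤ discord μ w')
    {v : V} (hv : Odd (Function.minimalPeriod σ v)) {w' : V → Bool}
    (h1 : ∀ u, σ.SameCycle v u → σ.SameCycle v (μ u) → w' (μ u) = w' u)
    (h2 : ∃ u, σ.SameCycle v u ∧ IsTurn σ w' u) :
    (Finset.univ.filter fun u => σ.SameCycle v u ∧ w u ≠ w (μ u)).card ≤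
      (Finset.univ.filter fun u => σ.SameCycle v u ∧ ¬ σ.SameCycle v (μ u) ∧
        w' u ≠ w (μ u)).card := by
  have hcons : ∀ u, σ.SameCycle v u → σ.SameCycle v (μ u) → w (μ u) = w u := by
    intro u hu hu'
    refine (hw u ?_).2 (hu.symm.trans hu')
    rwa [minimalPeriod_eq_of_sameCycle hu]
  obtain ⟨f, hf, f1, f2⟩ := hw.replace h1 h2
  have h := hmin f hf
  obtain ⟨C, hC⟩ : ∃ C : Set V, ∀ u, u ∈ C ↔ σ.SameCycle v u := ⟨{u | σ.SameCycle v u}, fun _ => Iff.rfl⟩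
  have d1 := discord_eq hμ C w fun u hu hu' => hcons u ((hC u).1 hu) ((hC _).1 hu')
  have d2 := discord_eq hμ C f fun u hu hu' => by
    rw [hC] at hu hu'
    rw [f1 _ hu, f1 _ hu', h1 u hu hu']
  have e1 : (Finset.univ.filter fun u => u ∉ C ∧ μ u ∉ C ∧ f u ≠ f (μ u)).card =
      (Finset.univ.filter fun u => u ∉ C ∧ μ u ∉ C ∧ w u ≠ w (μ u)).card := by
    congr 1
    ext u
    simp only [Finset.mem_filter, Finset.mem_univ, true_and, hC]
    refine and_congr_right fun a => and_congr_right fun b => ?_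
    rw [f2 _ a, f2 _ b]
  have e2 : (Finset.univ.filter fun u => u ∈ C ∧ μ u ∉ C ∧ f u ≠ f (μ u)).card =
      (Finset.univ.filter fun u => σ.SameCycle v u ∧ ¬ σ.SameCycle v (μ u) ∧
        w' u ≠ w (μ u)).card := by
    congr 1
    ext u
    simp only [Finset.mem_filter, Finset.mem_univ, true_and, hC]
    refine and_congr_right fun a => and_congr_right fun b => ?_
    rw [f1 _ a, f2 _ b]
  have e3 : (Finset.univ.filter fun u => u ∈ C ∧ μ u ∉ C ∧ w u ≠ w (μ u)).card =
      (Finset.univ.filter fun u => σ.SameCycle v u ∧ w u ≠ w (μ u)).card := by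
    congr 1
    ext u
    simp only [Finset.mem_filter, Finset.mem_univ, true_and, hC]
    refine and_congr_right fun a => ⟨fun h => h.2, fun h => ⟨fun b => h (hcons u a b).symm, h⟩⟩
  omega

/-- Primes are the values at the mates. By `x1` to `x4` disagreements do not occur in both halves of
the turn, so one half keeps its sign while the other is left with `0` or the opposite sign. -/
lemma isBreak_of_turn {a b c d a' b' c' d' : Bool} (h1 : a = b) (h2 : c = d) (h3 : a ≠ c)
    (x1 : a ≠ a' → c ≠ c' → False) (x2 : a ≠ a' → d ≠ d' → False) (x3 : b ≠ b' → c ≠ c' → False)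
    (x4 : b ≠ b' → d ≠ d' → False) :
    IsBreak (if a = a' then if a then 1 else -1 else 0) (if b = b' then if b then 1 else -1 else 0)
      (if c = c' then if c then 1 else -1 else 0) (if d = d' then if d then 1 else -1 else 0) := by
  subst h1 h2
  unfold IsBreak
  cases a <;> cases c <;> simp at h3 <;> cases a' <;> cases b' <;> cases c' <;> cases d' <;>
    simp at x1 x2 x3 x4 ⊢

-- In an admissible word of least discord, all disagreeing letters of an odd cycle have the same
-- value on that cycle. Otherwise the word copying the outer ends would not be constant there, and
-- `exists_isTurn_near` would make it admissible at the cost of at most one disagreement in place of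
-- at least two.
open Classical in
theorem exists_isBroken {V : Type*} [Fintype V] {σ : Equiv.Perm V} {μ : V → V}
    (h : IsSpread σ μ) : ∃ l, IsBroken σ μ l := by
  obtain ⟨w0, hw0⟩ := exists_isAdmissible h
  have : Nonempty {w : V → Bool // IsAdmissible σ μ w} := ⟨⟨w0, hw0⟩⟩
  obtain ⟨⟨w, hw⟩, hmin'⟩ := Finite.exists_min fun w : {w : V → Bool // IsAdmissible σ μ w} =>
    discord μ w.1
  have hmin : ∀ w', IsAdmissible σ μ w' → discord μ w ≤ discord μ w' := fun w' h' => hmin' ⟨w', h'⟩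
  have hμ := h.invol
  refine ⟨fun v => if w v = w (μ v) then (if w v then 1 else -1) else 0, ?_, ?_, ?_⟩
  · intro v
    simp only [hμ]
    by_cases hv : w v = w (μ v)
    · simp [hv]
    · simp [hv, Ne.symm hv]
  · intro v
    by_cases hv : w v = w (μ v)
    · cases hc : w v <;> simp [← hv, hc]
    · simp [hv]
  intro v hv
  obtain ⟨⟨u, hvu, ht⟩, -⟩ := hw v hv
  have s1 : σ.SameCycle v (σ u) := Equiv.Perm.sameCycle_apply_right.2 hvu
  have s2 : σ.SameCycle v (σ (σ u)) := Equiv.Perm.sameCycle_apply_right.2 s1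
  have s3 : σ.SameCycle v (σ (σ (σ u))) := Equiv.Perm.sameCycle_apply_right.2 s2
  refine ⟨u, hvu, ?_⟩
  have hcons : ∀ u, σ.SameCycle v u → σ.SameCycle v (μ u) → w (μ u) = w u := by
    intro u hu hu'
    refine (hw u ?_).2 (hu.symm.trans hu')
    rwa [minimalPeriod_eq_of_sameCycle hu]
  have cross : ∀ a b, σ.SameCycle v a → σ.SameCycle v b → w a ≠ w b → w a ≠ w (μ a) →
      w b ≠ w (μ b) → False := by
    intro a b ha hb hab ha' hb'
    obtain ⟨w', h1, h2, z, hz⟩ := exists_isTurn_near h hv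
      (y := fun x => if σ.SameCycle v (μ x) then w x else w (μ x)) (by
        intro x hx hx'
        simp [hx, hx', hμ, hcons x hx hx']) (by
        have na : ¬ σ.SameCycle v (μ a) := fun h => ha' (hcons a ha h).symm
        have nb : ¬ σ.SameCycle v (μ b) := fun h => hb' (hcons b hb h).symm
        by_contra! hcon
        have e1 := hcon a ha
        have e2 := hcon b hb
        rw [← e2] at e1
        simp only [na, nb, if_false] at e1
        revert hab ha' hb' e1
        cases w a <;> cases w b <;> cases w (μ a) <;> cases w (μ b) <;> simp)
    have hle := card_disagree_le hμ hw hmin hv h1 h2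
    have c1 : (Finset.univ.filter fun u => σ.SameCycle v u ∧ ¬ σ.SameCycle v (μ u) ∧
        w' u ≠ w (μ u)).card ≤ 1 := by
      rw [Finset.card_le_one]
      intro x hx y hy
      simp only [Finset.mem_filter, Finset.mem_univ, true_and] at hx hy
      rw [hz x hx.1 hx.2.1 (by simpa [hx.2.1] using hx.2.2),
        hz y hy.1 hy.2.1 (by simpa [hy.2.1] using hy.2.2)]
    have c2 : 1 < (Finset.univ.filter fun u => σ.SameCycle v u ∧ w u ≠ w (μ u)).card := by
      rw [Finset.one_lt_card]
      refine ⟨a, by simp [ha, ha'], b, by simp [hb, hb'], ?_⟩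
      rintro rfl
      exact hab rfl
    omega
  obtain ⟨t1, t2, t3⟩ := ht
  have x02 := cross u (σ (σ u)) hvu s2 t3
  have x03 := cross u (σ (σ (σ u))) hvu s3 (t2 ▸ t3)
  have x12 := cross (σ u) (σ (σ u)) s1 s2 (t1 ▸ t3)
  have x13 := cross (σ u) (σ (σ (σ u))) s1 s3 (t1 ▸ t2 ▸ t3)
  exact isBreak_of_turn t1 t2 t3 x02 x03 x12 x13

/-! ### Colouring the cycles in `ZMod 11` -/

/-- Two colours on a circle of length eleven have distance at least three. -/
def Far (a b : ZMod 11) : Prop := 3 ≤ (a - b).val ∧ (a - b).val ≤ 8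

instance (a b : ZMod 11) : Decidable (Far a b) := inferInstanceAs (Decidable (_ ∧ _))

lemma Far.symm {a b : ZMod 11} (h : Far a b) : Far b a := by
  revert a b
  decide

lemma Far.add_right {a b : ZMod 11} (h : Far a b) (c : ZMod 11) : Far (a + c) (b + c) := by
  unfold Far at *
  rwa [add_sub_add_right_eq_sub]

/-- The colours `x, y, z` followed by alternating colours `p, q`. -/
def patternColour (x y z p q : ZMod 11) (n : ℕ) : ZMod 11 :=
  if n = 0 then x else if n = 1 then y else if n = 2 then z else if Odd n then p else q

/-- Position `n` is the edge leaving the `n`-th vertex, and `l n` is the matching colour there. The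
edge entering vertex `0` has position `k - 1`, an even number above `2`, and so carries `q`. Since
`p` and `q` are far from every label, only the first four vertices need conditions. -/
lemma patternColour_far {k : ℕ} (hk : Odd k) (h5 : 5 ≤ k) {x y z p q : ZMod 11} {l : ℕ → ZMod 11}
    (hl : ∀ n, Far p (l n) ∧ Far q (l n)) (hpq : Far p q)
    (h0 : Far q x ∧ Far x (l 0)) (h1 : Far x y ∧ Far x (l 1) ∧ Far y (l 1))
    (h2 : Far y z ∧ Far y (l 2) ∧ Far z (l 2)) (h3 : Far z p ∧ Far z (l 3))
    {n : ℕ} (hn : n < k) :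
    Far (patternColour x y z p q (if n = 0 then k - 1 else n - 1)) (patternColour x y z p q n) ∧
    Far (patternColour x y z p q n) (l n) ∧
    Far (patternColour x y z p q (if n = 0 then k - 1 else n - 1)) (l n) := by
  obtain ⟨j, rfl⟩ := hk
  have e1 : ¬ Odd (2 * j) := by simp
  rcases n with _ | _ | _ | _ | n
  · have a : 2 * j ≠ 0 := by omega
    have b : 2 * j ≠ 1 := by omega
    have c : 2 * j ≠ 2 := by omega
    simp only [patternColour, if_true, Nat.add_sub_cancel, a, b, c, e1, if_false]
    exact ⟨h0.1, h0.2, (hl 0).2⟩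
  · simpa [patternColour] using ⟨h1.1, h1.2.2, h1.2.1⟩
  · simpa [patternColour] using ⟨h2.1, h2.2.2, h2.2.1⟩
  · have : Odd 3 := by decide
    simpa [patternColour, this] using ⟨h3.1, (hl 3).1, h3.2⟩
  · have o4 : Odd (n + 4) ↔ Odd n := by simp [Nat.odd_add, show Even 4 by decide]
    have o3 : Odd (n + 3) ↔ ¬ Odd n := by
      rw [Nat.odd_add, Nat.not_odd_iff_even]; simp [show ¬ Even 3 by decide]
    by_cases hn : Odd n
    · simpa [patternColour, o4, o3, hn] using ⟨hpq.symm, (hl (n + 4)).1, (hl (n + 4)).2⟩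
    · simpa [patternColour, o4, o3, hn] using ⟨hpq, (hl (n + 4)).2, (hl (n + 4)).1⟩

lemma altColour_far {k : ℕ} (hk : Even k) (h0 : 0 < k) {l : ℕ → ZMod 11}
    (hl : ∀ n, Far 4 (l n) ∧ Far 7 (l n)) {n : ℕ} (hn : n < k) :
    let F : ℕ → ZMod 11 := fun n => if Even n then 4 else 7
    Far (F (if n = 0 then k - 1 else n - 1)) (F n) ∧ Far (F n) (l n) ∧
    Far (F (if n = 0 then k - 1 else n - 1)) (l n) := by
  have h47 : Far 4 7 := by decide
  have h74 : Far 7 4 := by decide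
  intro F
  rcases n with _ | n
  · have : ¬ Even (k - 1) := by
      rw [Nat.even_sub (by omega)]; simp [hk]
    simpa [F, this] using ⟨h74, (hl 0).1, (hl 0).2⟩
  · by_cases he : Even n
    · have : ¬ Even (n + 1) := by simpa [Nat.even_add_one] using he
      simpa [F, he, this] using ⟨h47, (hl (n + 1)).2, (hl (n + 1)).1⟩
    · have : Even (n + 1) := by simpa [Nat.even_add_one] using he
      simpa [F, he, this] using ⟨h74, (hl (n + 1)).1, (hl (n + 1)).2⟩

open Function in
lemma exists_colour_sequence {V : Type*} [Finite V] {σ : Equiv.Perm V} {μ : V → V} {l : V → ℤ}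
    (hl : IsBroken σ μ l)
    (h5 : ∀ v, Odd (minimalPeriod σ v) → 5 ≤ minimalPeriod σ v) (v : V) :
    ∃ (u : V) (F : ℕ → ZMod 11), σ.SameCycle v u ∧ ∀ n < minimalPeriod σ u,
      Far (F (if n = 0 then minimalPeriod σ u - 1 else n - 1)) (F n) ∧ Far (F n) (l (σ^[n] u)) ∧
      Far (F (if n = 0 then minimalPeriod σ u - 1 else n - 1)) (l (σ^[n] u)) := by
  have hfar : ∀ u, Far 4 (l u : ZMod 11) ∧ Far 7 (l u : ZMod 11) := by
    intro u
    rcases hl.range u with h | h | h <;> rw [h] <;> decide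
  rcases Nat.even_or_odd (minimalPeriod σ v) with he | ho
  · refine ⟨v, _, Equiv.Perm.SameCycle.refl _ _, fun n hn => altColour_far he ?_
      (l := fun n => (l (σ^[n] v) : ZMod 11)) (fun n => hfar _) hn⟩
    omega
  · obtain ⟨u, hvu, hb⟩ := hl.break_odd v ho
    have hper := minimalPeriod_eq_of_sameCycle hvu
    have ho' : Odd (minimalPeriod σ u) := hper ▸ ho
    refine ⟨u, ?_⟩
    have r0 := hl.range u
    have r1 := hl.range (σ u)
    have r2 := hl.range (σ (σ u))
    have r3 := hl.range (σ (σ (σ u)))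
    rcases hb with ⟨a, b, c, d⟩ | ⟨a, b, c, d⟩ | ⟨a, b, c, d⟩ | ⟨a, b, c, d⟩
    -- Colour `6` is far from all labels, `3` only from `0` and `-1`, and `9` only from `1`. The
    -- other three cases arise from this one by reversing the cycle, negating the colours, or both.
    · refine ⟨patternColour 3 6 9 4 7, hvu, fun n hn => patternColour_far ho' (h5 u ho')
        (l := fun n => (l (σ^[n] u) : ZMod 11))
        (fun n => hfar _) (by decide) ?_ ?_ ?_ ?_ hn⟩ <;>
      simp only [iterate_succ, iterate_zero, comp_apply, id, c, d]
      · rcases r0 with r | r | r <;> rw [r] at a ⊢ <;> first | omega | decide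
      · rcases r1 with r | r | r <;> rw [r] at b ⊢ <;> first | omega | decide
      · decide
      · decide
    · refine ⟨patternColour 9 6 3 7 4, hvu, fun n hn => patternColour_far ho' (h5 u ho')
        (l := fun n => (l (σ^[n] u) : ZMod 11))
        (fun n => (hfar _).symm) (by decide) ?_ ?_ ?_ ?_ hn⟩ <;>
      simp only [iterate_succ, iterate_zero, comp_apply, id, a, b]
      · decide
      · decide
      · rcases r2 with r | r | r <;> rw [r] at c ⊢ <;> first | omega | decide
      · rcases r3 with r | r | r <;> rw [r] at d ⊢ <;> first | omega | decide
    · refine ⟨patternColour 2 5 8 4 7, hvu, fun n hn => patternColour_far ho' (h5 u ho')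
        (l := fun n => (l (σ^[n] u) : ZMod 11))
        (fun n => hfar _) (by decide) ?_ ?_ ?_ ?_ hn⟩ <;>
      simp only [iterate_succ, iterate_zero, comp_apply, id, a, b]
      · decide
      · decide
      · rcases r2 with r | r | r <;> rw [r] at c ⊢ <;> first | omega | decide
      · rcases r3 with r | r | r <;> rw [r] at d ⊢ <;> first | omega | decide
    · refine ⟨patternColour 8 5 2 7 4, hvu, fun n hn => patternColour_far ho' (h5 u ho')
        (l := fun n => (l (σ^[n] u) : ZMod 11))
        (fun n => (hfar _).symm) (by decide) ?_ ?_ ?_ ?_ hn⟩ <;>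
      simp only [iterate_succ, iterate_zero, comp_apply, id, c, d]
      · rcases r0 with r | r | r <;> rw [r] at a ⊢ <;> first | omega | decide
      · rcases r1 with r | r | r <;> rw [r] at b ⊢ <;> first | omega | decide
      · decide
      · decide

open Function in
/-- A broken labelling extends to a colouring of the edges `v — σ v`. -/
theorem exists_cycle_colouring {V : Type*} [Finite V] {σ : Equiv.Perm V} {μ : V → V} {l : V → ℤ}
    (hl : IsBroken σ μ l)
    (h5 : ∀ v, Odd (minimalPeriod σ v) → 5 ≤ minimalPeriod σ v) :
    ∃ e : V → ZMod 11, ∀ v, Far (e v) (e (σ v)) ∧ Far (e v) (l v) ∧ Far (e v) (l (σ v)) := by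
  classical
  choose b F hb hF using exists_colour_sequence hl h5
  let r : V → V := fun v => (Quotient.mk (Equiv.Perm.SameCycle.setoid σ) v).out
  have hr : ∀ v, σ.SameCycle (r v) v :=
    fun v => Quotient.mk_out (s := Equiv.Perm.SameCycle.setoid σ) v
  have hr' : ∀ v, r (σ v) = r v := by
    intro v
    have : Quotient.mk (Equiv.Perm.SameCycle.setoid σ) (σ v) = Quotient.mk _ v :=
      Quotient.sound (s := Equiv.Perm.SameCycle.setoid σ)
        (Equiv.Perm.sameCycle_apply_left.2 (Equiv.Perm.SameCycle.refl _ _))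
    simp only [r, this]
  have hex : ∀ v, ∃ n < minimalPeriod σ (b (r v)), σ^[n] (b (r v)) = v := by
    intro v
    obtain ⟨n, hn⟩ := ((hb (r v)).symm.trans (hr v)).exists_nat_pow_eq
    rw [← Equiv.Perm.iterate_eq_pow] at hn
    refine ⟨n % minimalPeriod σ (b (r v)), Nat.mod_lt _ ?_, ?_⟩
    · exact minimalPeriod_pos_of_mem_periodicPts (σ.injective.mem_periodicPts _)
    · rw [iterate_mod_minimalPeriod_eq, hn]
  choose N hN hN' using hex
  have huniq : ∀ v n, n < minimalPeriod σ (b (r v)) → σ^[n] (b (r v)) = v → n = N v := by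
    intro v n hn hn'
    exact iterate_injOn_Iio_minimalPeriod hn (hN v) (hn'.trans (hN' v).symm)
  refine ⟨fun v => F (r v) (N v), fun v => ?_⟩
  have hpos : 0 < minimalPeriod σ (b (r v)) :=
    minimalPeriod_pos_of_mem_periodicPts (σ.injective.mem_periodicPts _)
  have hv := hF (r v) (N v) (hN v)
  rw [hN' v] at hv
  have hs := hF (r v) (N (σ v)) (hr' v ▸ hN (σ v))
  have e1 : σ^[N (σ v)] (b (r v)) = σ v := by
    have := hN' (σ v)
    rwa [hr'] at this
  -- The edge entering `σ v` is the one leaving `v`, whether or not the numbering wraps around.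
  have e2 : (if N (σ v) = 0 then minimalPeriod σ (b (r v)) - 1 else N (σ v) - 1) = N v := by
    refine huniq v _ ?_ ?_
    · have := hN (σ v)
      rw [hr'] at this
      split_ifs <;> omega
    · apply σ.injective
      rw [← iterate_succ_apply' (⇑σ)]
      split_ifs with h
      · rw [Nat.succ_eq_add_one, Nat.sub_add_cancel hpos, iterate_minimalPeriod]
        rw [h] at e1
        exact e1
      · rw [Nat.succ_eq_add_one, Nat.sub_add_cancel (Nat.pos_of_ne_zero h), e1]
  rw [e1, e2] at hs
  simp only [hr']
  exact ⟨hs.1, hv.2.1, hs.2.2⟩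

/-! ### Cubic graphs with semi-edges, and their oriented `2`-factors -/

/-- A cubic multigraph with semi-edges: every vertex `v` carries the three darts `(v, i)`, and `ι`
exchanges the two darts of an edge and fixes the dart of a semi-edge. -/
structure CubicGraph (V : Type*) where
  ι : V × Fin 3 → V × Fin 3
  invol : ∀ d, ι (ι d) = d
  loopless : ∀ d, (ι d).1 = d.1 → ι d = d

namespace CubicGraph

variable {V : Type*}

/-- A circular `11/3`-edge-colouring exists. -/
def Colourable (G : CubicGraph V) : Prop :=
  ∃ c : V × Fin 3 → ZMod 11, (∀ d, c (G.ι d) = c d) ∧ ∀ v i j, i ≠ j → Far (c (v, i)) (c (v, j))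

def Adj (G : CubicGraph V) (u v : V) : Prop := ∃ i j, G.ι (u, i) = (v, j)

/-- The darts leaving a set of vertices. -/
def boundary (G : CubicGraph V) (A : Set V) : Set (V × Fin 3) := {d | d.1 ∈ A ∧ (G.ι d).1 ∉ A}

/-- The semi-edges. -/
def semi (G : CubicGraph V) : Set (V × Fin 3) := {d | G.ι d = d}

/-- A semi-edge never belongs to a boundary, so it does not count as a bridge. -/
def Bridgeless (G : CubicGraph V) : Prop := ∀ A : Set V, (G.boundary A).ncard ≠ 1

def TriangleFree (G : CubicGraph V) : Prop :=
  ∀ u v w, u ≠ v → v ≠ w → u ≠ w → G.Adj u v → G.Adj v w → G.Adj u w → False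

lemma ι_injective (G : CubicGraph V) : Function.Injective G.ι :=
  Function.LeftInverse.injective G.invol

/-- A perfect matching (given by the index of the matching dart at each vertex) containing all
semi-edges. -/
structure IsMatching (G : CubicGraph V) (m : V → Fin 3) : Prop where
  closed : ∀ v, (G.ι (v, m v)).2 = m (G.ι (v, m v)).1
  semi : ∀ d, G.ι d = d → d.2 = m d.1

/-- A perfect matching together with an orientation of the complementary `2`-factor. -/
structure OrientedFactor (G : CubicGraph V) where
  m : V → Fin 3
  o : V → Fin 3
  i : V → Fin 3
  σ : Equiv.Perm V
  o_ne_m : ∀ v, o v ≠ m v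
  i_ne_m : ∀ v, i v ≠ m v
  o_ne_i : ∀ v, o v ≠ i v
  mate : ∀ v, (G.ι (v, m v)).2 = m (G.ι (v, m v)).1
  next : ∀ v, G.ι (v, o v) = (σ v, i (σ v))

namespace OrientedFactor

variable {G : CubicGraph V} (T : G.OrientedFactor)

def μ (v : V) : V := (G.ι (v, T.m v)).1

lemma ι_m (v : V) : G.ι (v, T.m v) = (T.μ v, T.m (T.μ v)) := Prod.ext rfl (T.mate v)

lemma μ_μ (v : V) : T.μ (T.μ v) = v := by
  have := G.invol (v, T.m v)
  rw [T.ι_m] at this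
  exact congrArg Prod.fst this

lemma ι_i (v : V) : G.ι (v, T.i v) = (T.σ⁻¹ v, T.o (T.σ⁻¹ v)) := by
  have := T.next (T.σ⁻¹ v)
  simp only [Equiv.Perm.inv_def, Equiv.apply_symm_apply] at this ⊢
  rw [← this, G.invol]

lemma eq_of_ne {v : V} {j : Fin 3} (h1 : j ≠ T.m v) (h2 : j ≠ T.o v) : j = T.i v := by
  have a := T.o_ne_m v
  have b := T.i_ne_m v
  have c := T.o_ne_i v
  omega

lemma σ_ne (v : V) : T.σ v ≠ v := by
  intro h
  have h1 := T.next v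
  have h2 := G.loopless (v, T.o v) (by rw [h1, h])
  rw [h1, h] at h2
  exact T.o_ne_i v (congrArg Prod.snd h2).symm

theorem colourable [Finite V] {l : V → ℤ} (hl : IsBroken T.σ T.μ l)
    (h5 : ∀ v, Odd (Function.minimalPeriod T.σ v) → 5 ≤ Function.minimalPeriod T.σ v) :
    G.Colourable := by
  obtain ⟨e, he⟩ := exists_cycle_colouring hl h5
  obtain ⟨c, hc⟩ : ∃ c : V × Fin 3 → ZMod 11, c = fun d => if d.2 = T.m d.1 then (l d.1 : ZMod 11)
    else if d.2 = T.o d.1 then e d.1 else e (T.σ⁻¹ d.1) := ⟨_, rfl⟩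
  have cm : ∀ v, c (v, T.m v) = l v := fun v => by simp [hc]
  have co : ∀ v, c (v, T.o v) = e v := fun v => by simp [hc, T.o_ne_m]
  have ci : ∀ v, c (v, T.i v) = e (T.σ⁻¹ v) := fun v => by simp [hc, T.i_ne_m, (T.o_ne_i v).symm]
  have hcase : ∀ v j, j = T.m v ∨ j = T.o v ∨ j = T.i v := by
    intro v j
    by_contra! h
    exact h.2.2 (T.eq_of_ne h.1 h.2.1)
  refine ⟨c, ?_, ?_⟩
  · rintro ⟨v, j⟩
    rcases hcase v j with rfl | rfl | rfl
    · rw [T.ι_m, cm, cm, hl.invol]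
    · simp only [T.next, co, ci, Equiv.Perm.inv_def, Equiv.symm_apply_apply]
    · rw [T.ι_i, co, ci]
  · have f1 : ∀ v, Far (c (v, T.o v)) (c (v, T.m v)) := fun v => by
      rw [co, cm]; exact (he v).2.1
    have f2 : ∀ v, Far (c (v, T.i v)) (c (v, T.m v)) := fun v => by
      have := (he (T.σ⁻¹ v)).2.2
      simp only [Equiv.Perm.inv_def, Equiv.apply_symm_apply] at this ⊢
      rw [ci, cm]
      exact this
    have f3 : ∀ v, Far (c (v, T.i v)) (c (v, T.o v)) := fun v => by
      have := (he (T.σ⁻¹ v)).1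
      simp only [Equiv.Perm.inv_def, Equiv.apply_symm_apply] at this ⊢
      rw [ci, co]
      exact this
    intro v j k hjk
    rcases hcase v j with rfl | rfl | rfl <;> rcases hcase v k with rfl | rfl | rfl
    all_goals first
      | exact absurd rfl hjk
      | exact f1 v
      | exact f2 v
      | exact f3 v
      | exact (f1 v).symm
      | exact (f2 v).symm
      | exact (f3 v).symm

lemma adj_σ (v : V) : G.Adj v (T.σ v) := ⟨_, _, T.next v⟩

lemma adj_μ (v : V) : G.Adj v (T.μ v) := ⟨_, _, T.ι_m v⟩

-- An odd cycle of length below five would be a loop or a triangle, and a matching edge between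
-- points at distance two would close a triangle.
open Function in
lemma isSpread [Finite V] (hG : G.TriangleFree) : IsSpread T.σ T.μ := by
  have h5 : ∀ v, Odd (minimalPeriod T.σ v) → 5 ≤ minimalPeriod T.σ v := by
    intro v hv
    by_contra! hlt
    have hp : IsPeriodicPt T.σ (minimalPeriod T.σ v) v := isPeriodicPt_minimalPeriod _ _
    generalize minimalPeriod T.σ v = k at *
    obtain ⟨j, rfl⟩ := hv
    have : j = 0 ∨ j = 1 := by omega
    rcases this with rfl | rfl
    · exact T.σ_ne v hp
    · have h3 : T.σ (T.σ (T.σ v)) = v := hp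
      have hne : v ≠ T.σ (T.σ v) := fun h => T.σ_ne v (by
        nth_rw 1 [h]
        exact h3)
      refine hG v (T.σ v) (T.σ (T.σ v)) (T.σ_ne v).symm (T.σ_ne _).symm hne (T.adj_σ _) (T.adj_σ _) ?_
      refine ⟨T.i v, T.o (T.σ (T.σ v)), ?_⟩
      rw [T.ι_i]
      have : T.σ⁻¹ v = T.σ (T.σ v) := by
        rw [Equiv.Perm.inv_eq_iff_eq, h3]
      rw [this]
  refine ⟨T.μ_μ, h5, fun v hv h => ?_⟩
  have hne : v ≠ T.σ (T.σ v) := by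
    intro h2
    have : IsPeriodicPt T.σ 2 v := h2.symm
    have := Nat.le_of_dvd (by norm_num) this.minimalPeriod_dvd
    have := h5 v hv
    omega
  exact hG v (T.σ v) (T.σ (T.σ v)) (T.σ_ne v).symm (T.σ_ne _).symm hne (T.adj_σ _) (T.adj_σ _)
    (h ▸ T.adj_μ v)

theorem colourable_of_triangleFree [Finite V] {G : CubicGraph V} (T : G.OrientedFactor)
    (hG : G.TriangleFree) : G.Colourable := by
  have := Fintype.ofFinite V
  obtain ⟨l, hl⟩ := exists_isBroken (T.isSpread hG)
  exact T.colourable hl (T.isSpread hG).five_le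

end OrientedFactor

open Function in
/-- Two fixed-point-free involutions: a point and its image under one of them lie on different
cycles of the product. -/
lemma not_sameCycle_mul {N : Type*} [Finite N] {τ ρ : Equiv.Perm N} (hτ : ∀ d, τ (τ d) = d)
    (hρ : ∀ d, ρ (ρ d) = d) (hτ' : ∀ d, τ d ≠ d) (hρ' : ∀ d, ρ d ≠ d) (d : N) :
    ¬ (τ * ρ).SameCycle d (τ d) := by
  intro h
  obtain ⟨n, hn⟩ := h.exists_nat_pow_eq
  have hinv : τ⁻¹ = τ := Equiv.ext fun x => by rw [Equiv.Perm.inv_eq_iff_eq, hτ]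
  have hinv' : ρ⁻¹ = ρ := Equiv.ext fun x => by rw [Equiv.Perm.inv_eq_iff_eq, hρ]
  -- The dihedral relation: `τ` inverts `τ * ρ`. If `τ d` were reached from `d` in `n` steps, the
  -- midpoint of the walk would give a fixed point of `τ` for even `n` and of `ρ` for odd `n`.
  have conj1 : τ * (τ * ρ) * τ⁻¹ = (τ * ρ)⁻¹ := by
    rw [mul_inv_rev, hinv, hinv']
    ext x
    simp [hτ]
  have conj : ∀ k : ℕ, τ * (τ * ρ) ^ k = ((τ * ρ) ^ k)⁻¹ * τ := by
    intro k
    rw [← inv_pow, ← conj1, conj_pow, inv_mul_cancel_right]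
  rcases Nat.even_or_odd' n with ⟨k, rfl | rfl⟩
  · refine hτ' (((τ * ρ) ^ k) d) ?_
    rw [← Equiv.Perm.mul_apply, conj, Equiv.Perm.mul_apply, ← hn, Equiv.Perm.inv_eq_iff_eq,
      ← Equiv.Perm.mul_apply, ← pow_add, two_mul]
  · refine hρ' (((τ * ρ) ^ k) d) ?_
    have h1 : (τ * ρ) (((τ * ρ) ^ k) d) = τ (((τ * ρ) ^ k) d) := by
      rw [← Equiv.Perm.mul_apply, ← Equiv.Perm.mul_apply, conj, Equiv.Perm.mul_apply _ τ, ← hn,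
        eq_comm, Equiv.Perm.inv_eq_iff_eq, ← pow_succ', ← Equiv.Perm.mul_apply, ← pow_add]
      congr 2
      omega
    exact τ.injective h1

/-- Reversal-invariant choice of an orientation for the cycles of a product of two fixed-point-free
involutions. -/
lemma exists_orientation {N : Type*} [Finite N] {τ ρ : Equiv.Perm N} (hτ : ∀ d, τ (τ d) = d)
    (hρ : ∀ d, ρ (ρ d) = d) (hτ' : ∀ d, τ d ≠ d) (hρ' : ∀ d, ρ d ≠ d) :
    ∃ O : Set N, (∀ d, d ∈ O → τ (ρ d) ∈ O) ∧ ∀ d, τ d ∈ O ↔ d ∉ O := by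
  let q : N → Quotient (Equiv.Perm.SameCycle.setoid (τ * ρ)) := fun d => Quotient.mk _ d
  have hq : ∀ a b, q a = q b ↔ (τ * ρ).SameCycle a b := fun a b => Quotient.eq
  obtain ⟨n, ⟨g⟩⟩ := Finite.exists_equiv_fin (Quotient (Equiv.Perm.SameCycle.setoid (τ * ρ)))
  have hne : ∀ d, g (q d) ≠ g (q (τ d)) := fun d h =>
    not_sameCycle_mul hτ hρ hτ' hρ' d ((hq _ _).1 (g.injective h))
  -- The cycles of `d` and `τ d` are the two directions of one circuit; the one numbered first is
  -- kept.
  refine ⟨{d | g (q d) < g (q (τ d))}, fun d hd => ?_, fun d => ?_⟩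
  · have e1 : q (τ (ρ d)) = q d := by
      rw [hq]
      exact Equiv.Perm.sameCycle_apply_left.2 (Equiv.Perm.SameCycle.refl _ _)
    have e2 : q (τ (τ (ρ d))) = q (τ d) := by
      rw [hq, hτ]
      refine Equiv.Perm.SameCycle.symm ?_
      have : τ d = (τ * ρ) (ρ d) := by simp [hρ]
      rw [this]
      exact Equiv.Perm.sameCycle_apply_left.2 (Equiv.Perm.SameCycle.refl _ _)
    change g (q (τ (ρ d))) < g (q (τ (τ (ρ d))))
    rw [e1, e2]
    exact hd
  · change g (q (τ d)) < g (q (τ (τ d))) ↔ ¬ g (q d) < g (q (τ d))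
    rw [hτ, not_lt, le_iff_lt_or_eq, or_iff_left (hne d).symm]

/-- The complement of a perfect matching containing the semi-edges can be oriented. -/
theorem IsMatching.exists_orientedFactor [Finite V] {G : CubicGraph V} {m : V → Fin 3}
    (hm : G.IsMatching m) : ∃ T : G.OrientedFactor, T.m = m := by
  classical
  -- The elements of `Fin 3` sum to zero, so `-(a + b)` is the third index.
  have third : ∀ a b : Fin 3, a ≠ b → -(a + b) ≠ a ∧ -(a + b) ≠ b ∧ -(-(a + b) + b) = a ∧
      ∀ c, c ≠ a → c ≠ b → c = -(a + b) := by decide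
  have hclosed : ∀ d : V × Fin 3, d.2 ≠ m d.1 → (G.ι d).2 ≠ m (G.ι d).1 := by
    intro d hd h
    apply hd
    have h1 := hm.closed (G.ι d).1
    rw [← h] at h1
    simpa [G.invol] using h1
  let N := {d : V × Fin 3 // d.2 ≠ m d.1}
  -- The walk along the `2`-factor: `ρf` crosses an edge, `τf` passes to the other factor dart at
  -- the same vertex.
  let τf : N → N := fun d => ⟨(d.1.1, -(d.1.2 + m d.1.1)), (third _ _ d.2).2.1⟩
  have τf2 : Function.Involutive τf := fun d => Subtype.ext (Prod.ext rfl (third _ _ d.2).2.2.1)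
  let ρf : N → N := fun d => ⟨G.ι d.1, hclosed _ d.2⟩
  have ρf2 : Function.Involutive ρf := fun d => Subtype.ext (G.invol d.1)
  obtain ⟨O, hO, hO'⟩ := exists_orientation (τ := τf2.toPerm) (ρ := ρf2.toPerm) τf2 ρf2
    (fun d h => (third _ _ d.2).1 (congrArg (fun x : N => x.1.2) h))
    (fun d h => d.2 (hm.semi _ (congrArg Subtype.val h)))
  have hO1 : ∀ d, d ∈ O → τf (ρf d) ∈ O := hO
  have hO2 : ∀ d, τf d ∈ O ↔ d ∉ O := hO'
  have hex : ∀ v, ∃ j, ∃ h : j ≠ m v, (⟨(v, j), h⟩ : N) ∈ O := by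
    intro v
    obtain ⟨j, hj⟩ := exists_ne (m v)
    by_cases h : (⟨(v, j), hj⟩ : N) ∈ O
    · exact ⟨j, hj, h⟩
    · exact ⟨_, _, (hO2 _).2 h⟩
  choose o ho hoO using hex
  have huniq : ∀ d : N, d ∈ O → d.1.2 = o d.1.1 := by
    intro d hd
    by_contra hne
    refine (hO2 ⟨_, ho d.1.1⟩).1 ?_ (hoO d.1.1)
    convert hd using 1
    exact Subtype.ext (Prod.ext rfl ((third _ _ (ho d.1.1)).2.2.2 _ hne d.2).symm)
  have hnext : ∀ v, (G.ι (v, o v)).2 = -(o (G.ι (v, o v)).1 + m (G.ι (v, o v)).1) := by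
    intro v
    have h1 := huniq _ (hO1 _ (hoO v))
    have h2 : -((G.ι (v, o v)).2 + m (G.ι (v, o v)).1) = o (G.ι (v, o v)).1 := h1
    have h3 := third _ _ (hclosed (v, o v) (ho v))
    rw [← h2, h3.2.2.1]
  have hinj : Function.Injective fun v => (G.ι (v, o v)).1 := by
    intro v w hvw
    have h1 := hnext v
    have h2 := hnext w
    simp only at hvw
    rw [hvw, ← h2] at h1
    exact congrArg Prod.fst (G.ι_injective (Prod.ext hvw h1))
  refine ⟨⟨m, o, fun v => -(o v + m v), Equiv.ofBijective _ (Finite.injective_iff_bijective.1 hinj),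
    ho, fun v => (third _ _ (ho v)).2.1, fun v => (third _ _ (ho v)).1.symm, hm.closed, fun v => ?_⟩, rfl⟩
  exact Prod.ext rfl (hnext v)

end CubicGraph

/-! ### Perfect matchings and Petersen's theorem -/

lemma Finset.even_card_of_involutive {α : Type*} (s : Finset α) (f : α → α)
    (hf : ∀ a ∈ s, f (f a) = a) (hs : ∀ a ∈ s, f a ∈ s) (hne : ∀ a ∈ s, f a ≠ a) :
    Even s.card := by
  rw [← ZMod.natCast_eq_zero_iff_even, Finset.card_eq_sum_ones, Nat.cast_sum]
  refine Finset.sum_involution (fun a _ => f a) (fun a _ => by decide) (fun a ha _ => hne a ha)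
    hs hf

namespace CubicGraph

variable {V : Type*}

-- Of the `3 |A|` darts at `A`, those staying inside are paired off by `ι`, which fixes none of
-- them.
open Classical in
lemma odd_boundary [Finite V] (G : CubicGraph V) {A : Set V} (hA : Odd A.ncard)
    (hs : ∀ d, G.ι d = d → d.1 ∉ A) : Odd (G.boundary A).ncard := by
  have := Fintype.ofFinite V
  have e1 : (G.boundary A).ncard =
      (Finset.univ.filter fun d : V × Fin 3 => d.1 ∈ A ∧ (G.ι d).1 ∉ A).card := by
    rw [← Set.ncard_coe_finset]
    congr 1
    ext d
    simp [boundary]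
  have e2 : A.ncard * 3 = (Finset.univ.filter fun d : V × Fin 3 => d.1 ∈ A).card := by
    have : (Finset.univ.filter fun d : V × Fin 3 => d.1 ∈ A) =
        (Finset.univ.filter fun v : V => v ∈ A) ×ˢ (Finset.univ : Finset (Fin 3)) := by
      ext d
      simp
    rw [this, Finset.card_product, ← Set.ncard_coe_finset]
    simp
  have e3 := Finset.card_filter_add_card_filter_not (s := Finset.univ.filter fun d : V × Fin 3 => d.1 ∈ A)
    fun d => (G.ι d).1 ∈ A
  rw [Finset.filter_filter, Finset.filter_filter, ← e1, ← e2] at e3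
  have e4 : Even (Finset.univ.filter fun d : V × Fin 3 => d.1 ∈ A ∧ (G.ι d).1 ∈ A).card := by
    refine Finset.even_card_of_involutive _ G.ι (fun d _ => G.invol d) ?_ ?_
    · intro d hd
      simp only [Finset.mem_filter, Finset.mem_univ, true_and, G.invol] at hd ⊢
      exact hd.symm
    · intro d hd h
      simp only [Finset.mem_filter, Finset.mem_univ, true_and] at hd
      exact hs d h hd.1
  have e5 : Odd (A.ncard * 3) := hA.mul (by decide)
  rw [← e3, Nat.odd_add] at e5
  by_contra h
  rw [Nat.not_odd_iff_even, ← e5, ← Nat.not_even_iff_odd] at h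
  exact h e4

/-- An involution along edges, fixing only vertices with a semi-edge, picks out a matching. -/
lemma exists_isMatching_of_involution [Finite V] (G : CubicGraph V) (hs : G.semi.ncard ≤ 1)
    (p : V → V) (hp : ∀ v, p (p v) = v) (hadj : ∀ v, G.Adj v (p v))
    (hfix : ∀ d, G.ι d = d → p d.1 = d.1) : ∃ m, G.IsMatching m := by
  choose a b hab using hadj
  obtain ⟨n, ⟨g⟩⟩ := Finite.exists_equiv_fin V
  have hbb : ∀ v, p v = v → a v = b v := by
    intro v hv
    have h1 := hab v
    rw [hv] at h1
    have h2 := G.loopless (v, a v) (by rw [h1])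
    rw [h1] at h2
    exact (congrArg Prod.snd h2).symm
  -- Parallel edges leave a choice of darts, so the end numbered first by `g` decides; at a fixed
  -- vertex the two candidates agree by `hbb`.
  have hclosed : ∀ v, G.ι (v, if g v < g (p v) then a v else b (p v)) =
      (p v, if g (p v) < g (p (p v)) then a (p v) else b (p (p v))) := by
    intro v
    rw [hp]
    have hba : G.ι (v, b (p v)) = (p v, a (p v)) := by
      have := hab (p v)
      rw [hp] at this
      rw [← this, G.invol]
    rcases lt_trichotomy (g v) (g (p v)) with h | h | h
    · rw [if_pos h, if_neg h.asymm, hab]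
    · have hv : p v = v := (g.injective h).symm
      rw [if_neg h.not_lt, if_neg h.symm.not_lt, hba, hv, hbb v hv]
    · rw [if_neg h.asymm, if_pos h, hba]
  refine ⟨fun v => if g v < g (p v) then a v else b (p v), fun v => ?_, fun d hd => ?_⟩
  · simp only [hclosed]
  · have h1 := hclosed d.1
    have h2 := hfix d hd
    have h3 : (d.1, if g d.1 < g (p d.1) then a d.1 else b (p d.1)) ∈ G.semi :=
      G.loopless _ (by rw [h1, h2])
    have h4 := (Set.ncard_le_one_iff (Set.toFinite _)).1 hs (show d ∈ G.semi from hd) h3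
    exact congrArg Prod.snd h4

/-- The vertices carrying a semi-edge. -/
def semiVertices (G : CubicGraph V) : Set V := {v | ∃ i, G.ι (v, i) = (v, i)}

lemma three_le_boundary [Finite V] {G : CubicGraph V} (hG : G.Bridgeless) {A : Set V}
    (hA : Odd A.ncard) (hs : ∀ d, G.ι d = d → d.1 ∉ A) : 3 ≤ (G.boundary A).ncard := by
  obtain ⟨k, hk⟩ := G.odd_boundary hA hs
  have := hG A
  omega

/-- Few darts are available to receive the boundary darts of odd components. -/
lemma ncard_receivers_le [Finite V] {G : CubicGraph V} (hs : G.semi.ncard ≤ 1) (S : Set V) :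
    {d : V × Fin 3 | (d.1 ∈ S ∨ d.1 ∈ G.semiVertices) ∧ G.ι d ≠ d}.ncard ≤ S.ncard * 3 + 2 := by
  have hS : (S ×ˢ (Set.univ : Set (Fin 3))).ncard = S.ncard * 3 := by
    rw [Set.ncard_prod]
    simp
  by_cases hX : ∃ x i, G.ι (x, i) = (x, i)
  · obtain ⟨x, i, hx⟩ := hX
    have huniq : ∀ d, G.ι d = d → d = (x, i) := fun d hd =>
      (Set.ncard_le_one_iff (Set.toFinite _)).1 hs (show d ∈ G.semi from hd) hx
    have hsub : {d : V × Fin 3 | (d.1 ∈ S ∨ d.1 ∈ G.semiVertices) ∧ G.ι d ≠ d} ⊆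
        (S ×ˢ (Set.univ : Set (Fin 3))) ∪ {(x, i + 1), (x, i + 2)} := by
      rintro ⟨v, j⟩ ⟨h1 | ⟨k, hk⟩, h2⟩
      · exact Or.inl ⟨h1, trivial⟩
      · right
        have := huniq _ hk
        obtain rfl : v = x := congrArg Prod.fst this
        have hj : j ≠ i := by
          rintro rfl
          exact h2 hx
        have : j = i + 1 ∨ j = i + 2 := by omega
        rcases this with rfl | rfl <;> simp
    refine (Set.ncard_le_ncard hsub (Set.toFinite _)).trans ((Set.ncard_union_le _ _).trans ?_)
    rw [hS]
    have : ({(x, i + 1), (x, i + 2)} : Set (V × Fin 3)).ncard ≤ 2 :=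
      (Set.ncard_insert_le _ _).trans (by rw [Set.ncard_singleton])
    omega
  · have hsub : {d : V × Fin 3 | (d.1 ∈ S ∨ d.1 ∈ G.semiVertices) ∧ G.ι d ≠ d} ⊆
        (S ×ˢ (Set.univ : Set (Fin 3))) := by
      rintro ⟨v, j⟩ ⟨h1 | ⟨k, hk⟩, h2⟩
      · exact ⟨h1, trivial⟩
      · exact (hX ⟨v, k, hk⟩).elim
    refine (Set.ncard_le_ncard hsub (Set.toFinite _)).trans ?_
    omega

/-- Petersen's theorem, for bridgeless cubic graphs with at most one semi-edge. -/
theorem exists_isMatching [Finite V] {G : CubicGraph V} (hG : G.Bridgeless)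
    (hs : G.semi.ncard ≤ 1) : ∃ m, G.IsMatching m := by
  classical
  -- The vertex of the semi-edge, if any, is removed and will be fixed by the involution. Tutte's
  -- condition follows by counting: every odd component sends out at least three darts, all ending
  -- in `S` or at the removed vertex, which can receive at most `3 |S| + 2`. Hence there are at most
  -- `|S|` odd components.
  let W := {v : V // v ∉ G.semiVertices}
  have hsymm : ∀ u v, G.Adj u v → G.Adj v u := by
    rintro u v ⟨i, j, h⟩
    exact ⟨j, i, by rw [← h, G.invol]⟩
  let H : SimpleGraph W :=
    { Adj := fun u v => u ≠ v ∧ G.Adj u.1 v.1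
      symm := ⟨fun u v h => ⟨h.1.symm, hsymm _ _ h.2⟩⟩
      loopless := ⟨fun u h => h.1 rfl⟩ }
  have hM : ∃ M : SimpleGraph.Subgraph H, M.IsPerfectMatching := by
    rw [SimpleGraph.tutte]
    intro S hS
    rw [SimpleGraph.IsTutteViolator] at hS
    set D := (⊤ : H.Subgraph).deleteVerts S with hD
    let K : D.coe.ConnectedComponent → Set V := fun c => (fun x => x.1.1) '' c.supp
    have hinj : Function.Injective fun x : D.verts => x.1.1 :=
      fun x y h => Subtype.ext (Subtype.ext h)
    have hK : ∀ c ∈ D.coe.oddComponents, 3 ≤ (G.boundary (K c)).ncard := by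
      intro c hc
      refine three_le_boundary hG ?_ ?_
      · rw [Set.ncard_image_of_injective _ hinj]
        exact hc
      · rintro d hd ⟨x, -, hx⟩
        simp only at hx
        exact x.1.2 ⟨d.2, by rw [hx]; exact hd⟩
    have hf : ∀ c : D.coe.oddComponents, ∃ f : Fin 3 → V × Fin 3, Function.Injective f ∧
        ∀ j, f j ∈ G.boundary (K c) := by
      intro c
      obtain ⟨t, ht, htc⟩ := Set.exists_subset_card_eq (hK c.1 c.2)
      have hfin : t.Finite := Set.toFinite _
      have := Fintype.ofFinite t
      have hcard : Fintype.card t = 3 := by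
        rw [← Nat.card_eq_fintype_card]
        exact htc
      refine ⟨fun j => ((Fintype.equivFinOfCardEq hcard).symm j).1, fun i j h => ?_, fun j => ht ?_⟩
      · exact (Fintype.equivFinOfCardEq hcard).symm.injective (Subtype.ext h)
      · exact ((Fintype.equivFinOfCardEq hcard).symm j).2
    choose f hfi hfb using hf
    have key : ∀ c j, (((G.ι (f c j)).1 ∈ (fun x : W => x.1) '' S ∨
        (G.ι (f c j)).1 ∈ G.semiVertices) ∧ G.ι (G.ι (f c j)) ≠ G.ι (f c j)) := by
      intro c j
      obtain ⟨⟨x, hxc, hx⟩, h2⟩ := hfb c j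
      constructor
      · by_contra! hcon
        obtain ⟨n1, n2⟩ := hcon
        have hm : (⟨(G.ι (f c j)).1, n2⟩ : W) ∈ D.verts := by
          rw [hD, SimpleGraph.Subgraph.deleteVerts_verts]
          exact ⟨trivial, fun h => n1 ⟨_, h, rfl⟩⟩
        refine h2 ⟨⟨_, hm⟩, ?_, rfl⟩
        refine SimpleGraph.ConnectedComponent.mem_supp_of_adj_mem_supp c.1 hxc ?_
        have hne : x.1 ≠ (⟨(G.ι (f c j)).1, n2⟩ : W) := by
          intro h
          exact h2 ⟨x, hxc, congrArg Subtype.val h⟩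
        refine SimpleGraph.Subgraph.Adj.coe (u := x.1) (v := ⟨_, n2⟩) (H := D) ?_
        refine SimpleGraph.Subgraph.deleteVerts_adj.2 ?_
        have hverts : ∀ y, y ∈ D.verts → y ∉ S := fun y hy => by
          rw [hD, SimpleGraph.Subgraph.deleteVerts_verts] at hy
          exact hy.2
        refine ⟨trivial, hverts _ x.2, trivial, hverts _ hm, hne, (f c j).2, (G.ι (f c j)).2, ?_⟩
        simp only at hx
        rw [hx]
      · intro h
        have h3 := G.ι_injective h
        rw [h3] at h2
        exact h2 ⟨x, hxc, hx⟩
    have hle : Nat.card (D.coe.oddComponents × Fin 3) ≤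
        {d : V × Fin 3 | (d.1 ∈ (fun x : W => x.1) '' S ∨ d.1 ∈ G.semiVertices) ∧
          G.ι d ≠ d}.ncard := by
      refine Nat.card_le_card_of_injective
        (fun cj => ⟨G.ι (f cj.1 cj.2), key cj.1 cj.2⟩) ?_
      rintro ⟨c, j⟩ ⟨c', j'⟩ h
      have h1 : f c j = f c' j' := G.ι_injective (congrArg Subtype.val h)
      obtain ⟨⟨x, hxc, hx⟩, -⟩ := hfb c j
      obtain ⟨⟨x', hxc', hx'⟩, -⟩ := hfb c' j'
      have hxx : x = x' := hinj (by rw [hx, hx', h1])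
      have hcc : c = c' := Subtype.ext (by rw [← hxc, ← hxc', hxx])
      subst hcc
      rw [hfi c h1]
    have h2 := hle.trans (ncard_receivers_le hs _)
    rw [Nat.card_prod, Nat.card_coe_set_eq, Set.ncard_image_of_injective _ Subtype.val_injective] at h2
    simp only [Nat.card_eq_fintype_card, Fintype.card_fin] at h2
    omega
  obtain ⟨M, hM, hspan⟩ := hM
  have hpart : ∀ v : W, ∃ w : W, M.Adj v w ∧ ∀ y, M.Adj v y → y = w := fun v => hM (hspan v)
  choose q hq hq' using hpart
  have hqq : ∀ v, q (q v) = v := fun v => (hq' _ _ (hq v).symm).symm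
  refine exists_isMatching_of_involution G hs
    (fun v => if h : v ∉ G.semiVertices then (q ⟨v, h⟩).1 else v) ?_ ?_ ?_
  · intro v
    by_cases h : v ∉ G.semiVertices
    · have := (q ⟨v, h⟩).2
      simp only [h, not_false_eq_true, dite_true, this, Subtype.coe_eta, hqq]
    · simp only [h, dite_false]
  · intro v
    by_cases h : v ∉ G.semiVertices
    · simp only [h, not_false_eq_true, dite_true]
      exact (M.adj_sub (hq ⟨v, h⟩)).2
    · simp only [h, dite_false]
      push Not at h
      obtain ⟨i, hi⟩ := h
      exact ⟨i, i, hi⟩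
  · intro d hd
    have : ¬ d.1 ∉ G.semiVertices := fun h => h ⟨d.2, hd⟩
    simp only [this, dite_false]

/-- A bridgeless triangle-free cubic graph with at most one semi-edge is colourable. -/
theorem colourable_of_triangleFree [Finite V] {G : CubicGraph V} (hG : G.Bridgeless)
    (hs : G.semi.ncard ≤ 1) (ht : G.TriangleFree) : G.Colourable := by
  obtain ⟨m, hm⟩ := exists_isMatching hG hs
  obtain ⟨T, -⟩ := hm.exists_orientedFactor
  exact T.colourable_of_triangleFree ht

end CubicGraph

/-! ### Contracting triangles -/

namespace CubicGraph

variable {V : Type*}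

/-- Every proper nonempty set of vertices is left by at least two darts. -/
def Solid (G : CubicGraph V) : Prop :=
  ∀ A : Set V, A.Nonempty → A ≠ Set.univ → 2 ≤ (G.boundary A).ncard

lemma Solid.bridgeless {G : CubicGraph V} (hG : G.Solid) : G.Bridgeless := by
  intro A h
  by_cases h1 : A.Nonempty
  · by_cases h2 : A = Set.univ
    · subst h2
      simp [boundary] at h
    · have := hG A h1 h2
      omega
  · rw [Set.not_nonempty_iff_eq_empty] at h1
    subst h1
    simp [boundary] at h

/-- A `3`-edge-colouring which is proper except at the vertex of a semi-edge, where the two other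
darts have the same colour. -/
def Tait (G : CubicGraph V) : Prop :=
  ∃ s, G.ι s = s ∧ ∃ c : V × Fin 3 → Fin 3, (∀ d, c (G.ι d) = c d) ∧
    (∀ v j k, v ≠ s.1 → j ≠ k → c (v, j) ≠ c (v, k)) ∧
    ∀ j k, j ≠ s.2 → k ≠ s.2 → c (s.1, j) = c (s.1, k)

/-- A triangle `x 0, x 1, x 2`: `n k` and `b k` are the indices at `x k` of the darts to the next and
the previous vertex, and `e k` is the index of the third dart. -/
structure Triangle (G : CubicGraph V) where
  x : Fin 3 → V
  n : Fin 3 → Fin 3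
  b : Fin 3 → Fin 3
  e : Fin 3 → Fin 3
  inj : Function.Injective x
  n_ne_b : ∀ k, n k ≠ b k
  e_ne_n : ∀ k, e k ≠ n k
  e_ne_b : ∀ k, e k ≠ b k
  next : ∀ k, G.ι (x k, n k) = (x (k + 1), b (k + 1))

lemma exists_triangle {G : CubicGraph V} (hG : ¬ G.TriangleFree) : Nonempty G.Triangle := by
  unfold TriangleFree at hG
  push Not at hG
  obtain ⟨u, v, w, huv, hvw, huw, ⟨i1, j1, h1⟩, ⟨i2, j2, h2⟩, ⟨⟨i3, j3, h3⟩, -⟩⟩ := hG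
  have n0 : i1 ≠ i3 := by
    rintro rfl
    rw [h1] at h3
    exact hvw (congrArg Prod.fst h3)
  have h1' : G.ι (v, j1) = (u, i1) := by rw [← h1, G.invol]
  have h2' : G.ι (w, j2) = (v, i2) := by rw [← h2, G.invol]
  have h3' : G.ι (w, j3) = (u, i3) := by rw [← h3, G.invol]
  have n1 : i2 ≠ j1 := by
    rintro rfl
    rw [h1'] at h2
    exact huw (congrArg Prod.fst h2)
  have n2 : j3 ≠ j2 := by
    rintro rfl
    rw [h2'] at h3'
    exact huv (congrArg Prod.fst h3').symm
  have third : ∀ a b : Fin 3, a ≠ b → -(a + b) ≠ a ∧ -(a + b) ≠ b := by decide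
  refine ⟨⟨![u, v, w], ![i1, i2, j3], ![i3, j1, j2], ![-(i1 + i3), -(i2 + j1), -(j3 + j2)],
    ?_, ?_, ?_, ?_, ?_⟩⟩
  · intro a b hab
    fin_cases a <;> fin_cases b <;> simp_all
  · intro k
    fin_cases k <;> assumption
  · intro k
    fin_cases k
    · exact (third _ _ n0).1
    · exact (third _ _ n1).1
    · exact (third _ _ n2).1
  · intro k
    fin_cases k
    · exact (third _ _ n0).2
    · exact (third _ _ n1).2
    · exact (third _ _ n2).2
  · intro k
    fin_cases k
    · exact h1
    · exact h2
    · exact h3'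

namespace Triangle

variable {G : CubicGraph V} (T : G.Triangle)

lemma prev (k : Fin 3) : G.ι (T.x k, T.b k) = (T.x (k + 2), T.n (k + 2)) := by
  have h := T.next (k + 2)
  have : k + 2 + 1 = k := by omega
  rw [this] at h
  rw [← h, G.invol]

lemma eq_of_ne {k j : Fin 3} (h1 : j ≠ T.n k) (h2 : j ≠ T.b k) : j = T.e k := by
  have a := T.n_ne_b k
  have b := T.e_ne_n k
  have c := T.e_ne_b k
  omega

/-- The darts of the edges of the triangle. -/
def darts : Set (V × Fin 3) := {d | ∃ k, d = (T.x k, T.n k) ∨ d = (T.x k, T.b k)}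

lemma ι_mem {d : V × Fin 3} : G.ι d ∈ T.darts ↔ d ∈ T.darts := by
  have h : ∀ d ∈ T.darts, G.ι d ∈ T.darts := by
    rintro d ⟨k, rfl | rfl⟩
    · exact ⟨k + 1, Or.inr (T.next k)⟩
    · exact ⟨k + 2, Or.inl (T.prev k)⟩
  exact ⟨fun hd => by simpa [G.invol] using h _ hd, h d⟩

lemma e_notMem (k : Fin 3) : (T.x k, T.e k) ∉ T.darts := by
  rintro ⟨j, h | h⟩
  · have := T.inj (congrArg Prod.fst h)
    subst this
    exact T.e_ne_n _ (congrArg Prod.snd h)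
  · have := T.inj (congrArg Prod.fst h)
    subst this
    exact T.e_ne_b _ (congrArg Prod.snd h)

lemma notMem_of_ne {d : V × Fin 3} (h : ∀ k, d.1 ≠ T.x k) : d ∉ T.darts := by
  rintro ⟨k, rfl | rfl⟩ <;> exact h k rfl

/-- Extending a colouring of the other edges to the triangle. -/
lemma exists_extension {α : Type*} (g : V × Fin 3 → α) (hg : ∀ d ∉ T.darts, g (G.ι d) = g d)
    (t : Fin 3 → α) : ∃ c : V × Fin 3 → α, (∀ d, c (G.ι d) = c d) ∧ (∀ d ∉ T.darts, c d = g d) ∧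
      (∀ k, c (T.x k, T.n k) = t k) ∧ ∀ k, c (T.x k, T.b k) = t (k + 2) := by
  classical
  obtain ⟨c, hc⟩ : ∃ c : V × Fin 3 → α, c = fun d =>
      if d ∈ T.darts then if h : ∃ k, d = (T.x k, T.n k) then t h.choose
        else if h : ∃ k, d = (T.x k, T.b k) then t (h.choose + 2) else g d
      else g d := ⟨_, rfl⟩
  have c1 : ∀ d ∉ T.darts, c d = g d := fun d hd => by simp [hc, hd]
  have c2 : ∀ k, c (T.x k, T.n k) = t k := by
    intro k
    have hm : (T.x k, T.n k) ∈ T.darts := ⟨k, Or.inl rfl⟩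
    have h : ∃ j, (T.x k, T.n k) = (T.x j, T.n j) := ⟨k, rfl⟩
    have : h.choose = k := (T.inj (congrArg Prod.fst h.choose_spec)).symm
    rw [hc]
    simp only [hm, if_true]
    rw [dif_pos h, this]
  have c3 : ∀ k, c (T.x k, T.b k) = t (k + 2) := by
    intro k
    have hm : (T.x k, T.b k) ∈ T.darts := ⟨k, Or.inr rfl⟩
    have h0 : ¬ ∃ j, (T.x k, T.b k) = (T.x j, T.n j) := by
      rintro ⟨j, hj⟩
      have := T.inj (congrArg Prod.fst hj)
      subst this
      exact T.n_ne_b _ (congrArg Prod.snd hj).symm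
    have h : ∃ j, (T.x k, T.b k) = (T.x j, T.b j) := ⟨k, rfl⟩
    have : h.choose = k := (T.inj (congrArg Prod.fst h.choose_spec)).symm
    rw [hc]
    simp only [hm, if_true]
    rw [dif_neg h0, dif_pos h, this]
  refine ⟨c, fun d => ?_, c1, c2, c3⟩
  by_cases hd : d ∈ T.darts
  · obtain ⟨k, rfl | rfl⟩ := hd
    · rw [T.next, c3, c2]
      congr 1
      omega
    · rw [T.prev, c3, c2]
  · rw [c1 _ hd, c1 _ fun h => hd (T.ι_mem.1 h), hg d hd]

/-- The vertices of the contraction of the triangle; `x 0` stands for the contracted triangle. -/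
abbrev Quot : Type _ := {v : V // v ≠ T.x 1 ∧ v ≠ T.x 2}

/-- The vertex of the contraction replacing the triangle. -/
def root : T.Quot :=
  ⟨T.x 0, fun h => absurd (T.inj h) (by decide), fun h => absurd (T.inj h) (by decide)⟩

open Classical in
/-- The darts of the contraction, as darts of the original graph. -/
noncomputable def lift (d : T.Quot × Fin 3) : V × Fin 3 :=
  if d.1 = T.root then (T.x d.2, T.e d.2) else (d.1.1, d.2)

lemma lift_root (j : Fin 3) : T.lift (T.root, j) = (T.x j, T.e j) := by simp [lift]

lemma lift_of_ne {v : T.Quot} (hv : v ≠ T.root) (j : Fin 3) : T.lift (v, j) = (v.1, j) := by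
  simp [lift, hv]

lemma ne_x {v : T.Quot} (hv : v ≠ T.root) (k : Fin 3) : v.1 ≠ T.x k := by
  fin_cases k
  · exact fun h => hv (Subtype.ext h)
  · exact v.2.1
  · exact v.2.2

lemma lift_injective : Function.Injective T.lift := by
  rintro ⟨v, i⟩ ⟨w, j⟩ h
  by_cases hv : v = T.root <;> by_cases hw : w = T.root
  · subst hv hw
    rw [lift_root, lift_root] at h
    rw [T.inj (congrArg Prod.fst h)]
  · subst hv
    rw [lift_root, T.lift_of_ne hw] at h
    exact (T.ne_x hw _ (congrArg Prod.fst h).symm).elim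
  · subst hw
    rw [lift_root, T.lift_of_ne hv] at h
    exact (T.ne_x hv _ (congrArg Prod.fst h)).elim
  · rw [T.lift_of_ne hv, T.lift_of_ne hw] at h
    have h1 : v = w := Subtype.ext (congrArg Prod.fst h)
    have h2 : i = j := (Prod.mk.inj h).2
    rw [h1, h2]

lemma lift_notMem (d : T.Quot × Fin 3) : T.lift d ∉ T.darts := by
  obtain ⟨v, j⟩ := d
  by_cases hv : v = T.root
  · subst hv
    rw [lift_root]
    exact T.e_notMem j
  · rw [T.lift_of_ne hv]
    exact T.notMem_of_ne fun k => T.ne_x hv k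

lemma exists_lift {d : V × Fin 3} (hd : d ∉ T.darts) : ∃ d', T.lift d' = d := by
  obtain ⟨v, j⟩ := d
  by_cases h : ∃ k, v = T.x k
  · obtain ⟨k, rfl⟩ := h
    refine ⟨(T.root, k), ?_⟩
    rw [lift_root, ← T.eq_of_ne (k := k) (j := j) (fun h => hd ⟨k, Or.inl (by rw [h])⟩)
      fun h => hd ⟨k, Or.inr (by rw [h])⟩]
  · push Not at h
    refine ⟨(⟨v, h 1, h 2⟩, j), ?_⟩
    exact T.lift_of_ne (v := ⟨v, h 1, h 2⟩) (fun h' => h 0 (congrArg Subtype.val h')) j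

/-- Contraction of a triangle no two of whose exits form an edge. -/
lemma exists_contraction (hT : ∀ j k, j ≠ k → G.ι (T.x j, T.e j) ≠ (T.x k, T.e k)) :
    ∃ H : CubicGraph T.Quot, ∀ d, T.lift (H.ι d) = G.ι (T.lift d) := by
  have hex : ∀ d, ∃ d', T.lift d' = G.ι (T.lift d) := fun d =>
    T.exists_lift fun h => T.lift_notMem d (T.ι_mem.1 h)
  choose f hf using hex
  refine ⟨⟨f, fun d => T.lift_injective (by rw [hf, hf, G.invol]), ?_⟩, hf⟩
  rintro ⟨v, j⟩ h
  apply T.lift_injective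
  have h1 := hf (v, j)
  by_cases hv : v = T.root
  · subst hv
    obtain ⟨k, hk⟩ : ∃ k, f (T.root, j) = (T.root, k) :=
      ⟨(f (T.root, j)).2, Prod.ext h rfl⟩
    rw [hk, lift_root, lift_root] at h1
    rw [hk, lift_root, lift_root]
    by_cases hjk : j = k
    · rw [hjk]
    · exact (hT j k hjk h1.symm).elim
  · rw [h1]
    refine G.loopless _ ?_
    obtain ⟨k, hk⟩ : ∃ k, f (v, j) = (v, k) := ⟨(f (v, j)).2, Prod.ext h rfl⟩
    rw [← h1, hk, T.lift_of_ne hv, T.lift_of_ne hv]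

lemma semi_eq {T : G.Triangle} {H : CubicGraph T.Quot}
    (hH : ∀ d, T.lift (H.ι d) = G.ι (T.lift d)) : G.semi = T.lift '' H.semi := by
  ext d
  constructor
  · intro hd
    have : d ∉ T.darts := by
      rintro ⟨k, rfl | rfl⟩
      · have h1 : G.ι (T.x k, T.n k) = (T.x k, T.n k) := hd
        rw [T.next] at h1
        have := T.inj (congrArg Prod.fst h1)
        omega
      · have h1 : G.ι (T.x k, T.b k) = (T.x k, T.b k) := hd
        rw [T.prev] at h1
        have := T.inj (congrArg Prod.fst h1)
        omega
    obtain ⟨d', rfl⟩ := T.exists_lift this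
    refine ⟨d', T.lift_injective ?_, rfl⟩
    rw [hH]
    exact hd
  · rintro ⟨d', hd', rfl⟩
    have h : H.ι d' = d' := hd'
    change G.ι (T.lift d') = T.lift d'
    rw [← hH, h]

/-- Cuts of the contraction are exactly the cuts of `G` that do not separate the triangle. -/
lemma solid_contraction {T : G.Triangle} {H : CubicGraph T.Quot}
    (hH : ∀ d, T.lift (H.ι d) = G.ι (T.lift d)) (hG : G.Solid) : H.Solid := by
  classical
  let r : V → T.Quot := fun v => if h : v ≠ T.x 1 ∧ v ≠ T.x 2 then ⟨v, h⟩ else T.root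
  have rx : ∀ k, r (T.x k) = T.root := by
    intro k
    have h01 : T.x 0 ≠ T.x 1 := fun h => absurd (T.inj h) (by decide)
    have h02 : T.x 0 ≠ T.x 2 := fun h => absurd (T.inj h) (by decide)
    fin_cases k
    · simp [r, h01, h02, root]
    · simp [r]
    · simp [r]
  have rv : ∀ v : T.Quot, r v.1 = v := fun v => by simp only [r]; exact dif_pos v.2
  have rl : ∀ d, r (T.lift d).1 = d.1 := by
    rintro ⟨v, j⟩
    by_cases hv : v = T.root
    · subst hv
      rw [lift_root, rx]
    · rw [T.lift_of_ne hv, rv]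
  intro A hA hA'
  have hb : G.boundary (r ⁻¹' A) = T.lift '' H.boundary A := by
    ext d
    constructor
    · rintro ⟨h1, h2⟩
      have hd : d ∉ T.darts := by
        rintro ⟨k, rfl | rfl⟩
        · rw [T.next] at h2
          simp only [Set.mem_preimage, rx] at h1 h2
          exact h2 h1
        · rw [T.prev] at h2
          simp only [Set.mem_preimage, rx] at h1 h2
          exact h2 h1
      obtain ⟨d', rfl⟩ := T.exists_lift hd
      rw [← hH] at h2
      simp only [Set.mem_preimage, rl] at h1 h2
      exact ⟨d', ⟨h1, h2⟩, rfl⟩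
    · rintro ⟨d', ⟨h1, h2⟩, rfl⟩
      refine ⟨?_, ?_⟩
      · simpa only [Set.mem_preimage, rl] using h1
      · rw [← hH]
        simpa only [Set.mem_preimage, rl] using h2
  have h2 := hG (r ⁻¹' A) ?_ ?_
  · rwa [hb, Set.ncard_image_of_injective _ T.lift_injective] at h2
  · obtain ⟨a, ha⟩ := hA
    exact ⟨a.1, by rwa [Set.mem_preimage, rv]⟩
  · intro h
    apply hA'
    rw [Set.eq_univ_iff_forall] at h ⊢
    intro a
    have := h a.1
    rwa [Set.mem_preimage, rv] at this

lemma exists_lift_colouring {T : G.Triangle} {H : CubicGraph T.Quot}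
    (hH : ∀ d, T.lift (H.ι d) = G.ι (T.lift d))
    {α : Type*} {c' : T.Quot × Fin 3 → α} (hc' : ∀ d, c' (H.ι d) = c' d)
    (t : Fin 3 → α) : ∃ c : V × Fin 3 → α, (∀ d, c (G.ι d) = c d) ∧ (∀ d, c (T.lift d) = c' d) ∧
      (∀ k, c (T.x k, T.n k) = t k) ∧ ∀ k, c (T.x k, T.b k) = t (k + 2) := by
  classical
  obtain ⟨g, hg⟩ : ∃ g : V × Fin 3 → α, ∀ d, g (T.lift d) = c' d := by
    have : Nonempty α := ⟨t 0⟩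
    exact ⟨fun d => Function.extend T.lift c' (fun _ => t 0) d,
      fun d => T.lift_injective.extend_apply _ _ _⟩
  obtain ⟨c, h1, h2, h3⟩ := T.exists_extension g (fun d hd => by
    obtain ⟨d', rfl⟩ := T.exists_lift hd
    rw [← hH, hg, hg, hc']) t
  exact ⟨c, h1, fun d => by rw [h2 _ (T.lift_notMem d), hg], h3⟩

lemma vertex_cases (T : G.Triangle) {P : V → Fin 3 → Fin 3 → Prop} (hP : ∀ v i j, P v i j → P v j i)
    (hx : ∀ k, P (T.x k) (T.n k) (T.b k) ∧ P (T.x k) (T.n k) (T.e k) ∧ P (T.x k) (T.b k) (T.e k))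
    (hv : ∀ v : T.Quot, v ≠ T.root → ∀ i j, i ≠ j → P v.1 i j) :
    ∀ v i j, i ≠ j → P v i j := by
  intro v i j hij
  by_cases h : ∃ k, v = T.x k
  · obtain ⟨k, rfl⟩ := h
    have hcase : ∀ j, j = T.n k ∨ j = T.b k ∨ j = T.e k := by
      intro j
      by_contra! h
      exact h.2.2 (T.eq_of_ne h.1 h.2.1)
    obtain ⟨p1, p2, p3⟩ := hx k
    rcases hcase i with rfl | rfl | rfl <;> rcases hcase j with rfl | rfl | rfl
    all_goals first
      | exact absurd rfl hij
      | assumption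
      | (apply hP; assumption)
  · push Not at h
    exact hv ⟨v, h 1, h 2⟩ (fun h' => h 0 (congrArg Subtype.val h')) i j hij

/-- Each edge of the triangle takes the colour of the opposite exit, so every triangle vertex sees
the three colours of the contracted vertex. -/
lemma colourable_of_contraction {T : G.Triangle} {H : CubicGraph T.Quot}
    (hH : ∀ d, T.lift (H.ι d) = G.ι (T.lift d)) (h : H.Colourable) : G.Colourable := by
  obtain ⟨c', hc', hf⟩ := h
  obtain ⟨c, c1, c2, c3, c4⟩ := exists_lift_colouring hH hc' fun k => c' (T.root, k + 2)
  have ce : ∀ k, c (T.x k, T.e k) = c' (T.root, k) := fun k => by rw [← lift_root, c2]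
  refine ⟨c, c1, T.vertex_cases (fun v i j h => h.symm) (fun k => ⟨?_, ?_, ?_⟩) ?_⟩
  · rw [c3, c4]
    exact hf _ _ _ (by omega)
  · rw [c3, ce]
    exact hf _ _ _ (by omega)
  · rw [c4, ce]
    exact hf _ _ _ (by omega)
  · intro v hv i j hij
    rw [← T.lift_of_ne hv, ← T.lift_of_ne hv, c2, c2]
    exact hf _ _ _ hij

/-- If the semi-edge sits at the contracted vertex, it becomes the exit at `x l`. The two triangle
edges at `x l` then share one colour absent from the other exits, and the opposite edge takes the
remaining one. Elsewhere, opposite exits are copied as for `Colourable`. -/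
lemma tait_of_contraction {T : G.Triangle} {H : CubicGraph T.Quot}
    (hH : ∀ d, T.lift (H.ι d) = G.ι (T.lift d)) (h : H.Tait) : G.Tait := by
  obtain ⟨⟨v, l⟩, hs, c', hc', hp, hq⟩ := h
  have hsG : G.ι (T.lift (v, l)) = T.lift (v, l) := by rw [← hH, hs]
  by_cases hv : v = T.root
  · subst hv
    have h12 : c' (T.root, l + 1) = c' (T.root, l + 2) :=
      hq _ _ (by simp) (by simp)
    obtain ⟨c, c1, c2, c3, c4⟩ := exists_lift_colouring hH hc' fun m =>
      if m = l + 1 then c' (T.root, l + 1) + 2 else c' (T.root, l + 1) + 1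
    have ce : ∀ k, c (T.x k, T.e k) = c' (T.root, k) := fun k => by rw [← lift_root, c2]
    rw [lift_root] at hsG
    refine ⟨(T.x l, T.e l), hsG, c, c1, fun w i j hw hij => ?_, ?_⟩
    · refine T.vertex_cases (P := fun w i j => w ≠ T.x l → c (w, i) ≠ c (w, j))
        (fun v i j h hv => (h hv).symm) (fun k => ?_) ?_ w i j hij hw
      · rw [← forall_and, ← forall_and]
        intro hk
        have hkl : k ≠ l := fun h => hk (by rw [h])
        rw [c3, c4, ce]
        have : k = l + 1 ∨ k = l + 2 := by omega
        rcases this with rfl | rfl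
        · have e1 : ¬ l + 1 + 2 = l + 1 := by omega
          simp only [if_true, e1, if_false]
          refine ⟨?_, ?_, ?_⟩ <;> omega
        · have e1 : l + 2 + 2 = l + 1 := by omega
          have e2 : ¬ l + 2 = l + 1 := by omega
          simp only [if_true, e1, e2, if_false, ← h12]
          refine ⟨?_, ?_, ?_⟩ <;> omega
      · intro v hv i j hij _
        rw [← T.lift_of_ne hv, ← T.lift_of_ne hv, c2, c2]
        exact hp v i j hv hij
    · have key : ∀ j, j ≠ T.e l → c (T.x l, j) = c' (T.root, l + 1) + 1 := by
        intro j hj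
        by_cases hn : j = T.n l
        · rw [hn, c3, if_neg (by omega)]
        · have hb : j = T.b l := by
            by_contra hb
            exact hj (T.eq_of_ne hn hb)
          rw [hb, c4, if_neg (by omega)]
      intro j k hj hk
      rw [key j hj, key k hk]
  · obtain ⟨c, c1, c2, c3, c4⟩ := exists_lift_colouring hH hc' fun k => c' (T.root, k + 2)
    have ce : ∀ k, c (T.x k, T.e k) = c' (T.root, k) := fun k => by rw [← lift_root, c2]
    rw [T.lift_of_ne hv] at hsG
    refine ⟨(v.1, l), hsG, c, c1, fun w i j hw hij => ?_, fun j k hj hk => ?_⟩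
    · refine T.vertex_cases (P := fun w i j => w ≠ v.1 → c (w, i) ≠ c (w, j))
        (fun v i j h hv => (h hv).symm) (fun k => ?_) ?_ w i j hij hw
      · have hr : T.root ≠ v := fun h => hv h.symm
        rw [c3, c4, ce]
        exact ⟨fun _ => hp _ _ _ hr (by omega), fun _ => hp _ _ _ hr (by omega),
          fun _ => hp _ _ _ hr (by omega)⟩
      · intro u hu i j hij hne
        rw [← T.lift_of_ne hu, ← T.lift_of_ne hu, c2, c2]
        exact hp u i j (fun h => hne (by rw [h])) hij
    · rw [← T.lift_of_ne hv, ← T.lift_of_ne hv, c2, c2]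
      exact hq j k hj hk

/-- If two exits of a triangle form an edge then the third is a semi-edge and there are no other
vertices. -/
lemma tait_of_exits (T : G.Triangle) (hG : G.Solid) {j k : Fin 3} (hjk : j ≠ k)
    (h : G.ι (T.x j, T.e j) = (T.x k, T.e k)) : G.Tait := by
  have h' : G.ι (T.x k, T.e k) = (T.x j, T.e j) := by rw [← h, G.invol]
  have third : ∀ a b : Fin 3, ∃ l, l ≠ a ∧ l ≠ b := by decide
  obtain ⟨l, hlj, hlk⟩ := third j k
  have hall : ∀ m, m = j ∨ m = k ∨ m = l := by omega
  have hb : G.boundary (Set.range T.x) ⊆ {(T.x l, T.e l)} := by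
    rintro ⟨v, i⟩ ⟨⟨m, hm⟩, h2⟩
    simp only at hm
    subst hm
    by_cases hn : i = T.n m
    · subst hn
      exact (h2 ⟨_, by rw [T.next]⟩).elim
    by_cases hbm : i = T.b m
    · subst hbm
      exact (h2 ⟨_, by rw [T.prev]⟩).elim
    rw [T.eq_of_ne hn hbm] at h2 ⊢
    rcases hall m with rfl | rfl | rfl
    · exact (h2 ⟨_, by rw [h]⟩).elim
    · exact (h2 ⟨_, by rw [h']⟩).elim
    · rfl
  -- At most one dart leaves the triangle, so solidity leaves no further vertex.
  have huniv : Set.range T.x = Set.univ := by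
    by_contra hne
    have h1 := hG _ ⟨_, Set.mem_range_self 0⟩ hne
    have h2 := Set.ncard_le_ncard hb (Set.toFinite _)
    rw [Set.ncard_singleton] at h2
    omega
  have hsemi : G.ι (T.x l, T.e l) = (T.x l, T.e l) := by
    obtain ⟨m, hm⟩ : (G.ι (T.x l, T.e l)).1 ∈ Set.range T.x := huniv ▸ Set.mem_univ _
    refine G.loopless _ ?_
    have hnd : G.ι (T.x l, T.e l) ∉ T.darts := fun h => T.e_notMem l (T.ι_mem.1 h)
    have hme : G.ι (T.x l, T.e l) = (T.x m, T.e m) := by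
      refine Prod.ext hm.symm (T.eq_of_ne (fun hh => hnd ⟨m, Or.inl ?_⟩) fun hh => hnd ⟨m, Or.inr ?_⟩)
      · exact Prod.ext hm.symm hh
      · exact Prod.ext hm.symm hh
    rcases hall m with rfl | rfl | rfl
    · rw [← h', G.ι_injective.eq_iff] at hme
      exact (hlk (T.inj (congrArg Prod.fst hme))).elim
    · rw [← h, G.ι_injective.eq_iff] at hme
      exact (hlj (T.inj (congrArg Prod.fst hme))).elim
    · rw [hme]
  obtain ⟨c, c1, c2, c3, c4⟩ := T.exists_extension (fun _ => (0 : Fin 3)) (fun _ _ => rfl)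
    fun m => if m = l + 1 then 2 else 1
  have ce : ∀ k, c (T.x k, T.e k) = 0 := fun k => c2 _ (T.e_notMem k)
  refine ⟨(T.x l, T.e l), hsemi, c, c1, fun w i j hw hij => ?_, ?_⟩
  · refine T.vertex_cases (P := fun w i j => w ≠ T.x l → c (w, i) ≠ c (w, j))
      (fun v i j h hv => (h hv).symm) (fun k => ?_) ?_ w i j hij hw
    · rw [← forall_and, ← forall_and]
      intro hk
      have hkl : k ≠ l := fun h => hk (by rw [h])
      rw [c3, c4, ce]
      have : k = l + 1 ∨ k = l + 2 := by omega
      rcases this with rfl | rfl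
      · have e1 : ¬ l + 1 + 2 = l + 1 := by omega
        simp only [if_true, e1, if_false]
        decide
      · have e1 : l + 2 + 2 = l + 1 := by omega
        have e2 : ¬ l + 2 = l + 1 := by omega
        simp only [if_true, e1, e2, if_false]
        decide
    · intro v hv
      obtain ⟨m, hm⟩ : v.1 ∈ Set.range T.x := huniv ▸ Set.mem_univ _
      exact (T.ne_x hv m hm.symm).elim
  · have key : ∀ j, j ≠ T.e l → c (T.x l, j) = 1 := by
      intro j hj
      by_cases hn : j = T.n l
      · rw [hn, c3, if_neg (by omega)]
      · have hb : j = T.b l := by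
          by_contra hb
          exact hj (T.eq_of_ne hn hb)
        rw [hb, c4, if_neg (by omega)]
    intro j k hj hk
    rw [key j hj, key k hk]

end Triangle

universe u

/-- Induction on the number of vertices: contraction preserves solidity and the number of
semi-edges, and both outcomes lift back. -/
theorem colourable_or_tait {V : Type u} [Finite V] (G : CubicGraph V) (hG : G.Solid)
    (hs : G.semi.ncard ≤ 1) : G.Colourable ∨ G.Tait := by
  obtain ⟨n, hn⟩ : ∃ n, Nat.card V = n := ⟨_, rfl⟩
  induction n using Nat.strong_induction_on generalizing V with
  | _ n ih =>
    by_cases ht : G.TriangleFree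
    · exact Or.inl (colourable_of_triangleFree hG.bridgeless hs ht)
    obtain ⟨T⟩ := exists_triangle ht
    by_cases hT : ∀ j k, j ≠ k → G.ι (T.x j, T.e j) ≠ (T.x k, T.e k)
    · obtain ⟨H, hH⟩ := T.exists_contraction hT
      have hlt : Nat.card T.Quot < n := by
        rw [← hn]
        exact Finite.card_subtype_lt (x := T.x 1) (by simp)
      have hs' : H.semi.ncard ≤ 1 := by
        rwa [Triangle.semi_eq hH, Set.ncard_image_of_injective _ T.lift_injective] at hs
      rcases ih _ hlt H (Triangle.solid_contraction hH hG) hs' rfl with h | h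
      · exact Or.inl (Triangle.colourable_of_contraction hH h)
      · exact Or.inr (Triangle.tait_of_contraction hH h)
    · push Not at hT
      obtain ⟨j, k, hjk, h⟩ := hT
      exact Or.inr (T.tait_of_exits hG hjk h)

end CubicGraph

/-! ### Labellings when all odd cycles coincide, and circular distance -/

section

open Function

/-- A labelling around a window of four consecutive letters with no mates between its halves. -/
lemma exists_isBroken_of_window {V : Type*} [Finite V] {σ : Equiv.Perm V} {μ : V → V}
    (hμ : ∀ v, μ (μ v) = v) {u : V} (hodd : ∀ v, Odd (minimalPeriod σ v) → σ.SameCycle v u)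
    (h4 : 4 ≤ minimalPeriod σ u) (h02 : μ u ≠ σ^[2] u) (h03 : μ u ≠ σ^[3] u)
    (h12 : μ (σ^[1] u) ≠ σ^[2] u) (h13 : μ (σ^[1] u) ≠ σ^[3] u) : ∃ l, IsBroken σ μ l := by
  classical
  have hne : ∀ m n, m < 4 → n < 4 → m ≠ n → σ^[m] u ≠ σ^[n] u := fun m n hm hn hmn h =>
    hmn (iterate_injOn_Iio_minimalPeriod (Set.mem_Iio.2 (by omega)) (Set.mem_Iio.2 (by omega)) h)
  have h0 : ∀ n, n = 2 ∨ n = 3 → u ≠ σ^[n] u ∧ σ^[1] u ≠ σ^[n] u := by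
    rintro n (rfl | rfl)
    · exact ⟨hne 0 2 (by omega) (by omega) (by omega), hne 1 2 (by omega) (by omega) (by omega)⟩
    · exact ⟨hne 0 3 (by omega) (by omega) (by omega), hne 1 3 (by omega) (by omega) (by omega)⟩
  -- Label `1` goes to the letters of the right half of the window and `0` to all others; the
  -- absence of mates between the halves keeps the left half at `0`.
  obtain ⟨S, hS⟩ : ∃ S : Set V, ∀ v, v ∈ S ↔
    (v = σ^[2] u ∨ v = σ^[3] u) ∨ (μ v = σ^[2] u ∨ μ v = σ^[3] u) := ⟨{v | _}, fun _ => Iff.rfl⟩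
  refine ⟨fun v => if v ∈ S then 1 else 0, fun v => ?_, fun v => ?_, fun v hv => ?_⟩
  · have : μ v ∈ S ↔ v ∈ S := by
      rw [hS, hS, hμ, or_comm]
    simp only [this]
  · split_ifs <;> simp
  · refine ⟨u, hodd v hv, Or.inl ?_⟩
    have a0 : u ∉ S := by
      rw [hS]
      have := (h0 2 (Or.inl rfl)).1
      have := (h0 3 (Or.inr rfl)).1
      tauto
    have a1 : σ u ∉ S := by
      change σ^[1] u ∉ S
      rw [hS]
      have := (h0 2 (Or.inl rfl)).2
      have := (h0 3 (Or.inr rfl)).2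
      tauto
    have a2 : σ (σ u) ∈ S := (hS _).2 (Or.inl (Or.inl rfl))
    have a3 : σ (σ (σ u)) ∈ S := (hS _).2 (Or.inl (Or.inr rfl))
    simp [a0, a1, a2, a3]

/-- If every odd cycle passes through the fixed letter `x`, then there is a broken labelling unless
`x` lies on a triangle or on a pentagon with two crossing chords. -/
lemma exists_isBroken_of_fixed {V : Type*} [Finite V] {σ : Equiv.Perm V} {μ : V → V}
    (hμ : ∀ v, μ (μ v) = v) (hσ : ∀ v, σ v ≠ v) {x : V} (hx : μ x = x)
    (hodd : ∀ v, Odd (minimalPeriod σ v) → σ.SameCycle v x) :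
    (∃ l, IsBroken σ μ l ∧ ∀ v, Odd (minimalPeriod σ v) → 5 ≤ minimalPeriod σ v) ∨ σ^[3] x = x ∨
      (σ^[5] x = x ∧ μ (σ^[1] x) = σ^[3] x ∧ μ (σ^[2] x) = σ^[4] x) := by
  by_cases hox : Odd (minimalPeriod σ x)
  swap
  · have hno : ∀ v, ¬ Odd (minimalPeriod σ v) := fun v hv => hox (by
      rwa [minimalPeriod_eq_of_sameCycle (hodd v hv)])
    exact Or.inl ⟨fun _ => 0, ⟨fun _ => rfl, fun _ => Or.inr (Or.inl rfl), fun v hv => (hno v hv).elim⟩,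
      fun v hv => (hno v hv).elim⟩
  by_cases h3 : σ^[3] x = x
  · exact Or.inr (Or.inl h3)
  have h5 : 5 ≤ minimalPeriod σ x := by
    by_contra! hlt
    have hp : IsPeriodicPt σ (minimalPeriod σ x) x := isPeriodicPt_minimalPeriod _ _
    generalize minimalPeriod σ x = k at *
    obtain ⟨j, rfl⟩ := hox
    have : j = 0 ∨ j = 1 := by omega
    rcases this with rfl | rfl
    · exact hσ x hp
    · exact h3 hp
  have h5' : ∀ v, Odd (minimalPeriod σ v) → 5 ≤ minimalPeriod σ v := fun v hv => by
    rwa [← minimalPeriod_eq_of_sameCycle (hodd v hv)]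
  by_cases hl : ∃ l, IsBroken σ μ l
  · obtain ⟨l, hl⟩ := hl
    exact Or.inl ⟨l, hl, h5'⟩
  refine Or.inr (Or.inr ?_)
  -- From here on every window is blocked by a chord. The windows starting at `z`, `σ^[2] z` and
  -- `σ^[3] z` contain `x`, which is no end of a chord, and the few chords left to block them force
  -- the pentagon.
  obtain ⟨z, rfl⟩ : ∃ z, σ^[3] z = x := (σ.surjective.iterate 3) x
  have hit : ∀ m n, σ^[m] (σ^[n] z) = σ^[m + n] z := fun m n => (iterate_add_apply _ _ _ _).symm
  have hcyc : ∀ m n, σ.SameCycle (σ^[m] z) (σ^[n] z) := fun m n => by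
    rw [Equiv.Perm.iterate_eq_pow, Equiv.Perm.iterate_eq_pow]
    exact Equiv.Perm.sameCycle_pow_left.2 (Equiv.Perm.sameCycle_pow_right.2 (Equiv.Perm.SameCycle.refl _ _))
  obtain ⟨k, hk⟩ : ∃ k, k = minimalPeriod σ z := ⟨_, rfl⟩
  have hper : ∀ n, minimalPeriod σ (σ^[n] z) = k := fun n =>
    (minimalPeriod_eq_of_sameCycle (hcyc 0 n)).trans hk.symm
  rw [hper] at h5 hox
  have hne : ∀ m n, m < n → ¬ k ∣ n - m → σ^[m] z ≠ σ^[n] z := by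
    intro m n hmn hd h
    apply hd
    rw [← hper m]
    apply IsPeriodicPt.minimalPeriod_dvd
    unfold IsPeriodicPt IsFixedPt
    rw [hit, Nat.sub_add_cancel hmn.le, h]
  have hsmall : ∀ m n, m < n → n < m + 5 → σ^[m] z ≠ σ^[n] z := fun m n h1 h2 =>
    hne m n h1 fun hd => by have := Nat.le_of_dvd (by omega) hd; omega
  have hblock : ∀ n, μ (σ^[n] z) = σ^[n + 2] z ∨ μ (σ^[n] z) = σ^[n + 3] z ∨
      μ (σ^[n + 1] z) = σ^[n + 2] z ∨ μ (σ^[n + 1] z) = σ^[n + 3] z := by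
    intro n
    by_contra! h
    refine hl (exists_isBroken_of_window hμ (u := σ^[n] z) (fun v hv => (hodd v hv).trans (hcyc _ _))
      (by rw [hper]; omega) ?_ ?_ ?_ ?_)
    · rw [hit, add_comm]; exact h.1
    · rw [hit, add_comm]; exact h.2.1
    · rw [hit, hit, add_comm, add_comm 2]; exact h.2.2.1
    · rw [hit, hit, add_comm, add_comm 3]; exact h.2.2.2
  have hsymm : ∀ {a b}, μ a = b → μ b = a := fun {a b} h => by rw [← h, hμ]
  have hx' : ∀ {n}, μ (σ^[n] z) = σ^[3] z → σ^[n] z = σ^[3] z := fun {n} h => by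
    rw [← hsymm h, hx]
  have b0 : μ (σ^[2] z) = z ∨ μ (σ^[2] z) = σ^[1] z := by
    rcases hblock 0 with h | h | h | h
    · exact Or.inl (hsymm h)
    · exact (hsmall 0 3 (by omega) (by omega) (hx' h)).elim
    · exact Or.inr (hsymm h)
    · exact (hsmall 1 3 (by omega) (by omega) (hx' h)).elim
  have b2 : μ (σ^[2] z) = σ^[4] z ∨ μ (σ^[2] z) = σ^[5] z := by
    rcases hblock 2 with h | h | h | h
    · exact Or.inl h
    · exact Or.inr h
    · exact (hsmall 3 4 (by omega) (by omega) (hx.symm.trans h)).elim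
    · exact (hsmall 3 5 (by omega) (by omega) (hx.symm.trans h)).elim
  have b3 : μ (σ^[4] z) = σ^[5] z ∨ μ (σ^[4] z) = σ^[6] z := by
    rcases hblock 3 with h | h | h | h
    · exact (hsmall 3 5 (by omega) (by omega) (hx.symm.trans h)).elim
    · exact (hsmall 3 6 (by omega) (by omega) (hx.symm.trans h)).elim
    · exact Or.inl h
    · exact Or.inr h
  have c2 : μ (σ^[2] z) = σ^[5] z := by
    rcases b2 with h | h
    · exfalso
      rw [hsymm h] at b3
      rcases b3 with h' | h'
      · exact hsmall 2 5 (by omega) (by omega) h'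
      · exact hsmall 2 6 (by omega) (by omega) h'
    · exact h
  have c0 : σ^[5] z = z := by
    rcases b0 with h | h
    · exact c2.symm.trans h
    · exact (hsmall 1 5 (by omega) (by omega) (h.symm.trans c2)).elim
  have c5 : ∀ n, σ^[n + 5] z = σ^[n] z := fun n => by rw [iterate_add_apply, c0]
  have c3 : μ (σ^[4] z) = σ^[6] z := by
    rcases b3 with h | h
    · have := hsymm h
      rw [hsymm c2] at this
      exact (hsmall 2 4 (by omega) (by omega) this).elim
    · exact h
  simp only [hit]
  exact ⟨c5 3, c3, by rw [hsymm c2]; exact (c5 2).symm⟩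

/-- Circular distance at least `q` on a circle of length `p`. -/
def CircFar (p q a b : ℤ) : Prop := q ≤ |a - b| ∧ |a - b| ≤ p - q

lemma CircFar.symm {p q a b : ℤ} (h : CircFar p q a b) : CircFar p q b a := by
  unfold CircFar at *
  rwa [abs_sub_comm]

lemma circFar_iff {p q a b : ℤ} : CircFar p q a b ↔
    (q ≤ a - b ∨ a - b ≤ -q) ∧ a - b ≤ p - q ∧ q - p ≤ a - b := by
  unfold CircFar
  rw [le_abs, abs_le]
  constructor <;> rintro ⟨h1, h2, h3⟩ <;> refine ⟨?_, ?_, ?_⟩ <;> omega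

/-- Four points cannot have pairwise distance `q` on a circle of length less than `4 q`. -/
lemma not_circFar_four {p q a b c d : ℤ} (h : p < 4 * q) (ab : CircFar p q a b)
    (ac : CircFar p q a c) (ad : CircFar p q a d) (bc : CircFar p q b c) (bd : CircFar p q b d)
    (cd : CircFar p q c d) : False := by
  rw [circFar_iff] at *
  omega

lemma CircFar.rotate {p q a b : ℤ} (hq : 0 < q) (t : ℤ) (h : CircFar p q a b) :
    CircFar p q (if t ≤ a then a - t else a - t + p) (if t ≤ b then b - t else b - t + p) := by
  rw [circFar_iff] at *
  split_ifs <;> omega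

lemma CircFar.reflect {p q a b : ℤ} (h : CircFar p q a b) (ha : 0 ≤ a ∧ a < p) (hb : 0 ≤ b ∧ b < p) :
    CircFar p q (if a = 0 then 0 else p - a) (if b = 0 then 0 else p - b) := by
  rw [circFar_iff] at *
  split_ifs <;> omega

/-- In the pentagon `e i` joins vertices `i` and `i + 1`, the chord `f1` joins `1, 3`, and `f2`
joins `2, 4`; the colour `e1` is placed at `0`. Since `p < 4 * q`, both chords lie beyond `e2` and
`e3` is pushed into the arc around `0`. Then `e0` and `e4` fall into the same arc, less than `q`
apart, although they meet at vertex `0`. -/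
lemma not_pentagon_aux {p q e0 e2 e3 e4 f1 f2 : ℤ} (h : p < 4 * q)
    (r0 : 0 ≤ e0) (r2 : 0 ≤ e2) (r3 : 0 ≤ e3 ∧ e3 < p) (r4 : 0 ≤ e4 ∧ e4 < p)
    (s1 : 0 ≤ f1) (s2 : 0 ≤ f2) (h40 : CircFar p q e4 e0) (h01 : CircFar p q e0 0)
    (h0f : CircFar p q e0 f1) (h1f : CircFar p q 0 f1) (h12 : CircFar p q 0 e2)
    (h1f' : CircFar p q 0 f2) (h2f' : CircFar p q e2 f2) (h23 : CircFar p q e2 e3)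
    (h2f : CircFar p q e2 f1) (h3f : CircFar p q e3 f1) (h34 : CircFar p q e3 e4)
    (h3f' : CircFar p q e3 f2) (h4f' : CircFar p q e4 f2) (hlt : e2 < f2) : False := by
  rw [circFar_iff] at *
  have a1 : q ≤ e2 ∧ e2 + q ≤ f2 ∧ f2 ≤ p - q := by omega
  have a2 : e2 + q ≤ f1 ∧ f1 ≤ p - q := by omega
  have a3 : q ≤ e0 ∧ e0 ≤ f1 - q := by omega
  clear h01 h0f h1f h12 h1f' h2f' h2f
  rcases le_or_gt e3 e2 with hs | hs
  · have a4 : e3 ≤ e2 - q ∧ f1 + q - p ≤ e3 := by omega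
    clear h23 h3f h3f'
    omega
  · have a4 : f2 + q ≤ e3 ∧ f1 + q ≤ e3 := by omega
    clear h23 h3f h3f'
    omega

/-- The edges of a pentagon with two crossing chords, except at its vertex of degree two. -/
lemma not_pentagon {p q e0 e1 e2 e3 e4 f1 f2 : ℤ} (h : p < 4 * q) (hq : 0 < q)
    (r0 : 0 ≤ e0 ∧ e0 < p) (r1 : 0 ≤ e1 ∧ e1 < p) (r2 : 0 ≤ e2 ∧ e2 < p) (r3 : 0 ≤ e3 ∧ e3 < p)
    (r4 : 0 ≤ e4 ∧ e4 < p) (s1 : 0 ≤ f1 ∧ f1 < p) (s2 : 0 ≤ f2 ∧ f2 < p)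
    (h40 : CircFar p q e4 e0) (h01 : CircFar p q e0 e1)
    (h0f : CircFar p q e0 f1) (h1f : CircFar p q e1 f1) (h12 : CircFar p q e1 e2)
    (h1f' : CircFar p q e1 f2) (h2f' : CircFar p q e2 f2) (h23 : CircFar p q e2 e3)
    (h2f : CircFar p q e2 f1) (h3f : CircFar p q e3 f1) (h34 : CircFar p q e3 e4)
    (h3f' : CircFar p q e3 f2) (h4f' : CircFar p q e4 f2) : False := by
  obtain ⟨ρ, hρ⟩ : ∃ ρ : ℤ → ℤ, ρ = fun a => if e1 ≤ a then a - e1 else a - e1 + p := ⟨_, rfl⟩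
  have hf : ∀ {a b}, CircFar p q a b → CircFar p q (ρ a) (ρ b) := fun {a b} h => by
    rw [hρ]; exact h.rotate hq e1
  have h0 : ρ e1 = 0 := by simp [hρ]
  have hr : ∀ {a}, 0 ≤ a ∧ a < p → 0 ≤ ρ a ∧ ρ a < p := fun {a} h => by
    rw [hρ]
    simp only
    split_ifs <;> omega
  obtain ⟨κ, hκ⟩ : ∃ κ : ℤ → ℤ, κ = fun a => if a = 0 then 0 else p - a := ⟨_, rfl⟩
  have hkr : ∀ {a}, 0 ≤ a ∧ a < p → 0 ≤ κ a ∧ κ a < p := fun {a} h => by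
    rw [hκ]
    simp only
    split_ifs <;> omega
  have hkf : ∀ {a b}, 0 ≤ a ∧ a < p → 0 ≤ b ∧ b < p → CircFar p q (ρ a) (ρ b) →
      CircFar p q (κ (ρ a)) (κ (ρ b)) := fun {a b} ha hb h => by
    rw [hκ]
    exact h.reflect (hr ha) (hr hb)
  have k0 : κ 0 = 0 := by simp [hκ]
  have t1 := hf h01
  have t2 := hf h1f
  have t3 := hf h12
  have t4 := hf h1f'
  have u1 := hkf r0 r1 t1
  have u2 := hkf r1 s1 t2
  have u3 := hkf r1 r2 t3
  have u4 := hkf r1 s2 t4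
  rw [h0] at t1 t2 t3 t4 u1 u2 u3 u4
  rw [k0] at u1 u2 u3 u4
  -- With `e1` rotated to `0`, the reflection `κ` exchanges the two possible orders of `e2` and
  -- `f2`.
  rcases lt_or_ge (ρ e2) (ρ f2) with hlt | hge
  · exact not_pentagon_aux h (hr r0).1 (hr r2).1 (hr r3) (hr r4) (hr s1).1 (hr s2).1 (hf h40)
      t1 (hf h0f) t2 t3 t4 (hf h2f') (hf h23) (hf h2f) (hf h3f) (hf h34) (hf h3f') (hf h4f') hlt
  · refine not_pentagon_aux h (hkr (hr r0)).1 (hkr (hr r2)).1 (hkr (hr r3)) (hkr (hr r4))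
      (hkr (hr s1)).1 (hkr (hr s2)).1 (hkf r4 r0 (hf h40))
      u1 (hkf r0 s1 (hf h0f)) u2 u3 u4 (hkf r2 s2 (hf h2f')) (hkf r2 r3 (hf h23))
      (hkf r2 s1 (hf h2f)) (hkf r3 s1 (hf h3f)) (hkf r3 r4 (hf h34)) (hkf r3 s2 (hf h3f'))
      (hkf r4 s2 (hf h4f')) ?_
    have w1 := circFar_iff.1 (hf h2f')
    have w2 := circFar_iff.1 t3
    have w3 := circFar_iff.1 t4
    have w4 := hr r2
    have w5 := hr s2
    rw [hκ]
    simp only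
    split_ifs <;> omega

end

/-! ### Tait colourings in the presence of a colouring of ratio below `4` -/

section

open Function

namespace CubicGraph

variable {V : Type*}

/-- The edges other than the semi-edges have a circular edge-colouring with ratio less than `4`. -/
def CircColourable (G : CubicGraph V) : Prop :=
  ∃ p q : ℤ, 0 < q ∧ p < 4 * q ∧ ∃ c : V × Fin 3 → ℤ, (∀ d, 0 ≤ c d ∧ c d < p) ∧
    (∀ d, c (G.ι d) = c d) ∧ ∀ v i j, i ≠ j → G.ι (v, i) ≠ (v, i) → G.ι (v, j) ≠ (v, j) →
      CircFar p q (c (v, i)) (c (v, j))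

/-- Of the two exceptions in `exists_isBroken_of_fixed`, the pentagon contradicts `not_pentagon`;
the triangle remains. -/
lemma OrientedFactor.colourable_or_triangle [Finite V] {G : CubicGraph V} (T : G.OrientedFactor)
    (hG : G.CircColourable) {x : V} (hx : T.μ x = x)
    (hodd : ∀ v, Odd (minimalPeriod T.σ v) → T.σ.SameCycle v x) :
    G.Colourable ∨ T.σ (T.σ (T.σ x)) = x := by
  rcases exists_isBroken_of_fixed T.μ_μ T.σ_ne hx hodd with ⟨l, hl, h5⟩ | h | ⟨h5, h1, h2⟩
  · exact Or.inl (T.colourable hl h5)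
  · exact Or.inr h
  refine Or.inr ?_
  exfalso
  obtain ⟨p, q, hq, hpq, c, hr, hc, hf⟩ := hG
  have so : ∀ v, G.ι (v, T.o v) ≠ (v, T.o v) := fun v h => by
    rw [T.next] at h
    exact T.σ_ne v (congrArg Prod.fst h)
  have si : ∀ v, G.ι (v, T.i v) ≠ (v, T.i v) := fun v h => by
    rw [T.ι_i] at h
    have := congrArg Prod.fst h
    rw [Equiv.Perm.inv_eq_iff_eq] at this
    exact T.σ_ne v this.symm
  have sm : ∀ v, T.μ v ≠ v → G.ι (v, T.m v) ≠ (v, T.m v) := fun v hv h => by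
    rw [T.ι_m] at h
    exact hv (congrArg Prod.fst h)
  have ci : ∀ v, c (T.σ v, T.i (T.σ v)) = c (v, T.o v) := fun v => by rw [← T.next, hc]
  have cm : ∀ v, c (T.μ v, T.m (T.μ v)) = c (v, T.m v) := fun v => by rw [← T.ι_m, hc]
  have foi : ∀ v, CircFar p q (c (v, T.o v)) (c (T.σ v, T.o (T.σ v))) := fun v => by
    rw [← ci]
    exact hf _ _ _ (T.o_ne_i _).symm (si _) (so _)
  have fo : ∀ v, T.μ v ≠ v → CircFar p q (c (v, T.o v)) (c (v, T.m v)) := fun v hv =>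
    hf _ _ _ (T.o_ne_m _) (so _) (sm _ hv)
  have fi : ∀ v, T.μ (T.σ v) ≠ T.σ v →
      CircFar p q (c (v, T.o v)) (c (T.σ v, T.m (T.σ v))) := fun v hv => by
    rw [← ci]
    exact hf _ _ _ (T.i_ne_m _) (si _) (sm _ hv)
  simp only [iterate_succ, iterate_zero, comp_apply, id] at h5 h1 h2
  obtain ⟨y1, e1⟩ : ∃ y, y = T.σ x := ⟨_, rfl⟩
  obtain ⟨y2, e2⟩ : ∃ y, y = T.σ y1 := ⟨_, rfl⟩
  obtain ⟨y3, e3⟩ : ∃ y, y = T.σ y2 := ⟨_, rfl⟩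
  obtain ⟨y4, e4⟩ : ∃ y, y = T.σ y3 := ⟨_, rfl⟩
  simp only [← e1, ← e2, ← e3, ← e4] at h5 h1 h2
  have hne2 : ∀ v, T.σ (T.σ v) = v → T.σ (T.σ (T.σ (T.σ (T.σ v)))) = v → False := fun v h h' => by
    rw [h, h] at h'
    exact T.σ_ne v h'
  have n1 : y3 ≠ y1 := fun h => hne2 y1 (by rw [← e2, ← e3, h]) (by rw [← e2, ← e3, ← e4, h5, e1])
  have n2 : y4 ≠ y2 := fun h => hne2 y2 (by rw [← e3, ← e4, h]) (by rw [← e3, ← e4, h5, ← e1, e2])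
  have h1' : T.μ y3 = y1 := by rw [← h1, T.μ_μ]
  have h2' : T.μ y4 = y2 := by rw [← h2, T.μ_μ]
  have m1 : T.μ y1 ≠ y1 := by rw [h1]; exact n1
  have m2 : T.μ y2 ≠ y2 := by rw [h2]; exact n2
  have m3 : T.μ y3 ≠ y3 := by rw [h1']; exact n1.symm
  have m4 : T.μ y4 ≠ y4 := by rw [h2']; exact n2.symm
  have c1 := cm y1
  have c2 := cm y2
  rw [h1] at c1
  rw [h2] at c2
  have g40 := foi y4
  have g01 := foi x
  have g12 := foi y1
  have g23 := foi y2
  have g34 := foi y3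
  have f01 := fi x
  have f12 := fi y1
  have f23 := fi y2
  have f34 := fi y3
  rw [h5] at g40
  rw [← e1] at g01 f01
  rw [← e2] at g12 f12
  rw [← e3] at g23 f23
  rw [← e4] at g34 f34
  rw [c1] at f23
  rw [c2] at f34
  have o1 := fo y1 m1
  have o2 := fo y2 m2
  have o3 := fo y3 m3
  have o4 := fo y4 m4
  rw [c1] at o3
  rw [c2] at o4
  exact not_pentagon hpq hq (hr _) (hr _) (hr _) (hr _) (hr _) (hr _) (hr _) g40 g01 (f01 m1) o1 g12
    (f12 m2) o2 g23 (f23 m3) o3 g34 (f34 m4) o4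

/-- Deleting a colour class of a Tait colouring. -/
lemma colourable_or_edge_of_tait [Finite V] {G : CubicGraph V} (hG : G.CircColourable)
    {s : V × Fin 3} (hs : G.ι s = s) (huniq : ∀ d, G.ι d = d → d = s) {c : V × Fin 3 → Fin 3}
    (hc : ∀ d, c (G.ι d) = c d) (hp : ∀ v j k, v ≠ s.1 → j ≠ k → c (v, j) ≠ c (v, k)) {j k : Fin 3}
    (hj : j ≠ s.2) (hk : k ≠ s.2) (hjk : j ≠ k) (hcjk : c (s.1, j) = c (s.1, k)) {a : Fin 3}
    (ha : a ≠ c (s.1, j)) :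
    G.Colourable ∨ ∃ i i', G.ι ((G.ι (s.1, j)).1, i) = ((G.ι (s.1, k)).1, i') ∧
      c ((G.ι (s.1, j)).1, i) ≠ c (s.1, j) ∧ c ((G.ι (s.1, j)).1, i) ≠ a := by
  have three : ∀ a b c d : Fin 3, a ≠ d → b ≠ d → c ≠ d → b ≠ a → c ≠ b → c = a := by omega
  obtain ⟨x, i0⟩ := s
  simp only at *
  have hex : ∀ v, ∃ i, v ≠ x → c (v, i) = a := by
    intro v
    by_cases hv : v = x
    · exact ⟨0, fun h => (h hv).elim⟩
    · have : Injective fun i => c (v, i) := fun i i' h => by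
        by_contra hne
        exact hp v i i' hv hne h
      obtain ⟨i, hi⟩ := (Finite.injective_iff_surjective.1 this) a
      exact ⟨i, fun _ => hi⟩
  choose m0 hm0 using hex
  classical
  obtain ⟨m, hm⟩ : ∃ m : V → Fin 3, m = fun v => if v = x then i0 else m0 v := ⟨_, rfl⟩
  have hmx : m x = i0 := by simp [hm]
  have hmv : ∀ v, v ≠ x → c (v, m v) = a := fun v hv => by
    simp only [hm, hv, if_false]
    exact hm0 v hv
  have hmuniq : ∀ v i, v ≠ x → c (v, i) = a → i = m v := fun v i hv h => by
    by_contra hne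
    exact hp v i _ hv hne (h.trans (hmv v hv).symm)
  have hxc : ∀ i, i ≠ i0 → c (x, i) = c (x, j) := by
    intro i hi
    have : i = j ∨ i = k := by omega
    rcases this with rfl | rfl
    · rfl
    · exact hcjk.symm
  -- Colour `a` is absent from the two other darts at `x`, so its class away from `x`, together with
  -- the semi-edge, is a perfect matching.
  have hmatch : G.IsMatching m := by
    refine ⟨fun v => ?_, fun d hd => ?_⟩
    · by_cases hv : v = x
      · subst hv
        rw [hmx, hs, hmx]
      · have h1 : c (G.ι (v, m v)) = a := by rw [hc, hmv v hv]
        have h2 := G.invol (v, m v)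
        rcases hd : G.ι (v, m v) with ⟨w, i⟩
        rw [hd] at h1 h2
        by_cases hw : w = x
        · subst hw
          by_cases hi : i = i0
          · subst hi
            rw [hs] at h2
            exact (hv (congrArg Prod.fst h2).symm).elim
          · exact (ha (h1.symm.trans (hxc i hi))).elim
        · exact hmuniq w i hw h1
    · rw [huniq d hd, hmx]
  obtain ⟨T, rfl⟩ := hmatch.exists_orientedFactor
  have hμ : T.μ x = x := by
    rw [OrientedFactor.μ, hmx, hs]
  have co : ∀ v, c (v, T.o v) ≠ a := by
    intro v h
    by_cases hv : v = x
    · subst hv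
      exact ha (h.symm.trans (hxc _ (hmx ▸ T.o_ne_m v)))
    · exact T.o_ne_m v (hmuniq v _ hv h)
  have cstep : ∀ v, T.σ v ≠ x → c (T.σ v, T.o (T.σ v)) ≠ c (v, T.o v) := by
    intro v hv h
    rw [← hc (v, T.o v), T.next] at h
    exact hp _ _ _ hv (T.o_ne_i _) h
  -- On a cycle avoiding `x` the two remaining colours alternate, so its length is even.
  have hodd : ∀ v, Odd (minimalPeriod T.σ v) → T.σ.SameCycle v x := by
    intro v hv
    by_contra hvx
    have hnx : ∀ n, T.σ^[n] v ≠ x := fun n h => hvx (by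
      rw [← h, Equiv.Perm.iterate_eq_pow]
      exact Equiv.Perm.sameCycle_pow_right.2 (Equiv.Perm.SameCycle.refl _ _))
    have hstep : ∀ n, c (T.σ^[n + 1] v, T.o (T.σ^[n + 1] v)) ≠ c (T.σ^[n] v, T.o (T.σ^[n] v)) := by
      intro n
      have h1 := hnx (n + 1)
      rw [iterate_succ_apply'] at h1 ⊢
      exact cstep _ h1
    have heven : ∀ n, c (T.σ^[2 * n] v, T.o (T.σ^[2 * n] v)) = c (v, T.o v) := by
      intro n
      induction n with
      | zero => rfl
      | succ n ih =>
        rw [← ih]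
        exact three _ _ _ a (co _) (co _) (co _) (hstep _) (hstep (2 * n + 1))
    obtain ⟨n, hn⟩ := hv
    have h1 := hstep (2 * n)
    rw [heven, ← hn, iterate_minimalPeriod] at h1
    exact h1 rfl
  rcases T.colourable_or_triangle hG hμ hodd with h | h
  · exact Or.inl h
  refine Or.inr ?_
  have hi : T.σ⁻¹ x = T.σ (T.σ x) := by rw [Equiv.Perm.inv_eq_iff_eq, h]
  have n1 : T.σ x ≠ x := T.σ_ne x
  have n2 : T.σ (T.σ x) ≠ x := fun h' => by
    rw [h'] at h
    exact n1 h
  have q1 : c (T.σ x, T.o (T.σ x)) ≠ c (x, j) := by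
    rw [← hxc (T.o x) (hmx ▸ T.o_ne_m x)]
    exact cstep x n1
  have q2 : c (T.σ (T.σ x), T.i (T.σ (T.σ x))) = c (T.σ x, T.o (T.σ x)) := by
    rw [← T.next, hc]
  have e1 := T.next x
  have e2 := T.ι_i x
  rw [hi] at e2
  have oi : (T.o x = j ∧ T.i x = k) ∨ (T.o x = k ∧ T.i x = j) := by
    have := T.o_ne_m x
    have := T.i_ne_m x
    have := T.o_ne_i x
    rw [hmx] at *
    omega
  rcases oi with ⟨r1, r2⟩ | ⟨r1, r2⟩
  · rw [r1] at e1
    rw [r2] at e2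
    rw [e1, e2]
    exact ⟨_, _, T.next (T.σ x), q1, co _⟩
  · rw [r1] at e1
    rw [r2] at e2
    rw [e1, e2]
    refine ⟨T.i (T.σ (T.σ x)), T.o (T.σ x), ?_, ?_, ?_⟩
    · rw [← T.next, G.invol]
    · rw [q2]; exact q1
    · rw [q2]; exact co _

/-- Let `y`, `z` be the neighbours of the vertex `x` of the semi-edge. Deleting either colour class
not containing `x y` fails only if `y` and `z` are joined by an edge of the other one. If both fail,
`x y`, `x z` and two parallel edges `y z` are pairwise adjacent, which `not_circFar_four` forbids.
-/
theorem Tait.colourable [Finite V] {G : CubicGraph V} (h : G.Tait) (hs : G.semi.ncard ≤ 1)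
    (hG : G.CircColourable) : G.Colourable := by
  obtain ⟨s, hss, c, hc, hp, hx⟩ := h
  have huniq : ∀ d, G.ι d = d → d = s := fun d hd =>
    (Set.ncard_le_one (Set.toFinite _)).1 hs d hd s hss
  have two : ∀ a : Fin 3, ∃ j k, j ≠ a ∧ k ≠ a ∧ j ≠ k := by decide
  obtain ⟨j, k, hj, hk, hjk⟩ := two s.2
  obtain ⟨a, b, ha, hb, hab⟩ := two (c (s.1, j))
  rcases colourable_or_edge_of_tait hG hss huniq hc hp hj hk hjk (hx j k hj hk) ha with
    h | ⟨i1, i1', h1, u1, v1⟩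
  · exact h
  rcases colourable_or_edge_of_tait hG hss huniq hc hp hj hk hjk (hx j k hj hk) hb with
    h | ⟨i2, i2', h2, u2, v2⟩
  · exact h
  exfalso
  have hji : G.ι (s.1, j) ≠ (s.1, j) := fun h => hj (congrArg Prod.snd (huniq _ h))
  have hki : G.ι (s.1, k) ≠ (s.1, k) := fun h => hk (congrArg Prod.snd (huniq _ h))
  have hcj := hc (s.1, j)
  have hck := hc (s.1, k)
  obtain ⟨p, q, hq, hpq, e, -, he, hf⟩ := hG
  have hej := he (s.1, j)
  have hek := he (s.1, k)
  have hkj := hx j k hj hk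
  have hy : (G.ι (s.1, j)).1 ≠ s.1 := fun h => hji (G.loopless _ h)
  have hz : (G.ι (s.1, k)).1 ≠ s.1 := fun h => hki (G.loopless _ h)
  obtain ⟨⟨y, m⟩, hyd⟩ : ∃ d, G.ι (s.1, j) = d := ⟨_, rfl⟩
  obtain ⟨⟨z, n⟩, hzd⟩ : ∃ d, G.ι (s.1, k) = d := ⟨_, rfl⟩
  rw [hyd] at h1 h2 u1 u2 v1 v2 hcj hej hy
  rw [hzd] at h1 h2 hck hek hz
  dsimp only at h1 h2 u1 u2 v1 v2 hy hz
  have w1 : i1 ≠ m := by rintro rfl; exact u1 hcj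
  have w2 : i2 ≠ m := by rintro rfl; exact u2 hcj
  have three : ∀ a b c d e: Fin 3, a ≠ b → a ≠ c → b ≠ c → d ≠ a → d ≠ b → e ≠ a → e ≠ c → d ≠ e := by
    decide
  have w12 : i1 ≠ i2 := by
    rintro rfl
    exact three _ a b _ _ ha.symm hb.symm hab u1 v1 u2 v2 rfl
  have c1 := hc (y, i1)
  have c2 := hc (y, i2)
  rw [h1] at c1
  rw [h2] at c2
  have w1' : i1' ≠ n := by rintro rfl; exact u1 (c1.symm.trans (hck.trans hkj.symm))
  have w2' : i2' ≠ n := by rintro rfl; exact u2 (c2.symm.trans (hck.trans hkj.symm))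
  have f1 := he (y, i1)
  have f2 := he (y, i2)
  rw [h1] at f1
  rw [h2] at f2
  have hns : ∀ {v i}, v ≠ s.1 → G.ι (v, i) ≠ (v, i) := fun {v i} hv h =>
    hv (congrArg Prod.fst (huniq _ h))
  have p1 := hf _ j k hjk hji hki
  have p2 := hf _ _ _ w1 (hns hy) (hns hy)
  have p3 := hf _ _ _ w2 (hns hy) (hns hy)
  have p4 := hf _ _ _ w12 (hns hy) (hns hy)
  have p5 := hf _ _ _ w1' (hns hz) (hns hz)
  have p6 := hf _ _ _ w2' (hns hz) (hns hz)
  rw [hej] at p2 p3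
  rw [hek, f1] at p5
  rw [hek, f2] at p6
  exact not_circFar_four hpq p1 p2.symm p3.symm p5.symm p6.symm p4

end CubicGraph

end

/-! ### Several semi-edges, and small cuts -/

namespace CubicGraph

universe u

variable {V : Type u}

open Classical in
/-- Two copies of a graph, joined along the semi-edges. -/
noncomputable def double (G : CubicGraph V) : CubicGraph (V × Bool) where
  ι d := if G.ι (d.1.1, d.2) = (d.1.1, d.2) then ((d.1.1, !d.1.2), d.2)
    else (((G.ι (d.1.1, d.2)).1, d.1.2), (G.ι (d.1.1, d.2)).2)
  invol := by
    rintro ⟨⟨v, b⟩, i⟩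
    by_cases h : G.ι (v, i) = (v, i)
    · simp [h]
    · have h' : G.ι (v, i) ≠ G.ι (G.ι (v, i)) := fun h' => h (by rw [G.invol] at h'; exact h')
      have h'' : ¬ (v, i) = G.ι (v, i) := fun h' => h h'.symm
      simp [h, G.invol, h'']
  loopless := by
    rintro ⟨⟨v, b⟩, i⟩
    by_cases h : G.ι (v, i) = (v, i)
    · simp [h]
    · intro h'
      simp only [h, if_false, Prod.mk.injEq, and_true] at h'
      exact (h (G.loopless (v, i) h')).elim

lemma double_semi (G : CubicGraph V) {v : V} {i : Fin 3} (h : G.ι (v, i) = (v, i)) (b : Bool) :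
    G.double.ι ((v, b), i) = ((v, !b), i) := by
  simp [double, h]

lemma double_of_ne (G : CubicGraph V) {v : V} {i : Fin 3} (h : G.ι (v, i) ≠ (v, i)) (b : Bool) :
    G.double.ι ((v, b), i) = (((G.ι (v, i)).1, b), (G.ι (v, i)).2) := by
  simp [double, h]

lemma double_ne (G : CubicGraph V) (d : (V × Bool) × Fin 3) : G.double.ι d ≠ d := by
  obtain ⟨⟨v, b⟩, i⟩ := d
  by_cases h : G.ι (v, i) = (v, i)
  · rw [double_semi _ h]
    simp
  · rw [double_of_ne _ h]
    intro h'
    simp only [Prod.mk.injEq] at h'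
    exact h (Prod.ext h'.1.1 h'.2)

/-- A set splitting one of the copies is cut there as in `G`; otherwise it is a whole copy and is
cut by all the semi-edges. -/
lemma Solid.double [Finite V] {G : CubicGraph V} (hG : G.Solid) (hs : 2 ≤ G.semi.ncard) :
    G.double.Solid := by
  intro A hA hA'
  have hinj : ∀ b : Bool, Function.Injective fun d : V × Fin 3 => ((d.1, b), d.2) := by
    rintro b ⟨v, i⟩ ⟨w, j⟩ h
    simp only [Prod.mk.injEq] at h
    exact Prod.ext h.1.1 h.2
  by_cases hb : ∃ b, ∃ v w, (v, b) ∈ A ∧ (w, b) ∉ A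
  · obtain ⟨b, v, w, hv, hw⟩ := hb
    refine (hG {u | (u, b) ∈ A} ⟨v, hv⟩ fun h => hw ?_).trans ?_
    · have : w ∈ {u | (u, b) ∈ A} := h ▸ Set.mem_univ w
      exact this
    · rw [← Set.ncard_image_of_injective _ (hinj b)]
      refine Set.ncard_le_ncard ?_ (Set.toFinite _)
      rintro _ ⟨⟨u, i⟩, ⟨h1, h2⟩, rfl⟩
      have hne : G.ι (u, i) ≠ (u, i) := fun h => h2 (by rw [h]; exact h1)
      refine ⟨h1, ?_⟩
      rw [double_of_ne _ hne]
      exact h2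
  · push Not at hb
    obtain ⟨⟨v, b⟩, hv⟩ := hA
    have hall : ∀ u, (u, b) ∈ A := fun u => hb b v u hv
    have hnone : ∀ u, (u, !b) ∉ A := fun u hu => hA' (by
      rw [Set.eq_univ_iff_forall]
      rintro ⟨w, b'⟩
      by_cases h : b' = b
      · exact h ▸ hall w
      · have : b' = !b := by revert h; cases b' <;> cases b <;> simp
        exact this ▸ hb _ u w hu)
    refine hs.trans ?_
    rw [← Set.ncard_image_of_injective _ (hinj b)]
    refine Set.ncard_le_ncard ?_ (Set.toFinite _)
    rintro _ ⟨⟨u, i⟩, h, rfl⟩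
    refine ⟨hall u, ?_⟩
    rw [double_semi _ h]
    exact hnone u

/-- The double has no semi-edge, hence no Tait colouring; its colouring is restricted to one copy.
-/
lemma Solid.colourable_of_two_le [Finite V] {G : CubicGraph V} (hG : G.Solid)
    (hs : 2 ≤ G.semi.ncard) : G.Colourable := by
  have hempty : G.double.semi = ∅ := Set.eq_empty_iff_forall_notMem.2 fun d hd => G.double_ne d hd
  rcases colourable_or_tait G.double (hG.double hs) (by simp [hempty]) with ⟨c, hc, hf⟩ | ⟨s, h, -⟩
  · refine ⟨fun d => c ((d.1, true), d.2), ?_, fun v i j h => hf _ _ _ h⟩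
    rintro ⟨v, i⟩
    by_cases h : G.ι (v, i) = (v, i)
    · rw [h]
    · have := hc ((v, true), i)
      rwa [double_of_ne _ h] at this
  · exact (G.double_ne s h).elim

open Classical in
/-- The graph induced on a set of vertices; the darts leaving the set become semi-edges. -/
noncomputable def induce (G : CubicGraph V) (A : Set V) : CubicGraph A where
  ι d := if h : (G.ι (d.1, d.2)).1 ∈ A then (⟨_, h⟩, (G.ι (d.1, d.2)).2) else d
  invol := by
    rintro ⟨⟨v, hv⟩, i⟩
    by_cases h : (G.ι (v, i)).1 ∈ A
    · simp [h, G.invol, hv]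
    · simp [h]
  loopless := by
    rintro ⟨⟨v, hv⟩, i⟩
    by_cases h : (G.ι (v, i)).1 ∈ A
    · intro h'
      simp only [h, dif_pos, Subtype.mk.injEq] at h'
      have := G.loopless (v, i) h'
      simp [this, hv]
    · simp [h]

lemma induce_of_mem (G : CubicGraph V) {A : Set V} {v : V} (hv : v ∈ A) {i : Fin 3}
    (h : (G.ι (v, i)).1 ∈ A) :
    (G.induce A).ι (⟨v, hv⟩, i) = (⟨_, h⟩, (G.ι (v, i)).2) := by
  simp [induce, h]

/-- Cut edges become semi-edges, on which `CircColourable` imposes no distance condition. -/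
lemma CircColourable.induce {G : CubicGraph V} (hG : G.CircColourable) (A : Set V) :
    (G.induce A).CircColourable := by
  obtain ⟨p, q, hq, hpq, c, hr, hc, hf⟩ := hG
  have hsemi : ∀ (v : A) i, (G.induce A).ι (v, i) ≠ (v, i) → G.ι (v.1, i) ≠ (v.1, i) := by
    rintro ⟨v, hv⟩ i h h'
    dsimp only at h'
    have h2 : (G.ι (v, i)).1 ∈ A := by rw [h']; exact hv
    rw [induce_of_mem _ _ h2] at h
    exact h (by simp [h'])
  refine ⟨p, q, hq, hpq, fun d => c (d.1, d.2), fun d => hr _, ?_,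
    fun v i j hij h1 h2 => hf _ _ _ hij (hsemi _ _ h1) (hsemi _ _ h2)⟩
  rintro ⟨⟨v, hv⟩, i⟩
  by_cases h : (G.ι (v, i)).1 ∈ A
  · rw [induce_of_mem _ _ h]
    exact hc (v, i)
  · simp [CubicGraph.induce, h]

lemma exists_colour_of_induce {G : CubicGraph V} {A : Set V} (h : (G.induce A).Colourable) :
    ∃ c : V × Fin 3 → ZMod 11, (∀ d, d.1 ∈ A → (G.ι d).1 ∈ A → c (G.ι d) = c d) ∧
      ∀ v i j, v ∈ A → i ≠ j → Far (c (v, i)) (c (v, j)) := by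
  classical
  obtain ⟨c, hc, hf⟩ := h
  obtain ⟨e, he⟩ : ∃ e : V × Fin 3 → ZMod 11, ∀ v (hv : v ∈ A) i, e (v, i) = c (⟨v, hv⟩, i) :=
    ⟨fun d => if h : d.1 ∈ A then c (⟨d.1, h⟩, d.2) else 0, fun v hv i => by simp [hv]⟩
  refine ⟨e, ?_, fun v i j hv hij => ?_⟩
  · rintro ⟨v, i⟩ hv h
    have := hc (⟨v, hv⟩, i)
    rw [induce_of_mem _ _ h] at this
    rw [he v hv, ← this]
    exact he _ h _
  · rw [he v hv, he v hv]
    exact hf _ _ _ hij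

/-- Colourings of the two sides of a cut of size at most one can be combined. -/
lemma colourable_of_induce [Finite V] {G : CubicGraph V} {A : Set V}
    (hA : (G.boundary A).ncard ≤ 1) (h1 : (G.induce A).Colourable)
    (h2 : (G.induce Aᶜ).Colourable) : G.Colourable := by
  classical
  obtain ⟨c1, hc1, hf1⟩ := exists_colour_of_induce h1
  obtain ⟨c2, hc2, hf2⟩ := exists_colour_of_induce h2
  -- At most one edge crosses the cut, so a rotation by `t` makes the two sides agree on it.
  obtain ⟨t, ht⟩ : ∃ t, ∀ d ∈ G.boundary A, c1 d = c2 (G.ι d) + t := by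
    by_cases hb : (G.boundary A).Nonempty
    · obtain ⟨d0, hd0⟩ := hb
      refine ⟨c1 d0 - c2 (G.ι d0), fun d hd => ?_⟩
      rw [(Set.ncard_le_one (Set.toFinite _)).1 hA d hd d0 hd0]
      ring
    · exact ⟨0, fun d hd => (hb ⟨d, hd⟩).elim⟩
  obtain ⟨c, hc⟩ : ∃ c : V × Fin 3 → ZMod 11, c = fun d => if d.1 ∈ A then c1 d else c2 d + t :=
    ⟨_, rfl⟩
  have p1 : ∀ d : V × Fin 3, d.1 ∈ A → c d = c1 d := fun d h => by simp [hc, h]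
  have p2 : ∀ d : V × Fin 3, d.1 ∉ A → c d = c2 d + t := fun d h => by simp [hc, h]
  refine ⟨c, fun d => ?_, fun v i j hij => ?_⟩
  · by_cases hd : d.1 ∈ A <;> by_cases hd' : (G.ι d).1 ∈ A
    · rw [p1 _ hd, p1 _ hd', hc1 d hd hd']
    · rw [p1 _ hd, p2 _ hd', ht d ⟨hd, hd'⟩]
    · rw [p2 _ hd, p1 _ hd', ht (G.ι d) ⟨hd', by rwa [G.invol]⟩, G.invol]
    · rw [p2 _ hd, p2 _ hd', hc2 d hd hd']
  · by_cases hv : v ∈ A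
    · rw [p1 _ hv, p1 _ hv]
      exact hf1 _ _ _ hv hij
    · rw [p2 _ hv, p2 _ hv]
      exact (hf2 _ _ _ hv hij).add_right t

/-- Induction on the number of vertices: a graph that is not solid splits along a cut of at most one
edge, and a solid one is settled by its number of semi-edges. The ratio below `4` enters only in the
Tait case. -/
theorem CircColourable.colourable [Finite V] {G : CubicGraph V} (hG : G.CircColourable) :
    G.Colourable := by
  induction h : Nat.card V using Nat.strong_induction_on generalizing V with
  | _ n ih =>
    by_cases hS : G.Solid
    · rcases le_or_gt G.semi.ncard 1 with hs | hs
      · exact (colourable_or_tait G hS hs).elim id fun hT => hT.colourable hs hG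
      · exact hS.colourable_of_two_le hs
    · unfold Solid at hS
      push Not at hS
      obtain ⟨A, hA, hA', hb⟩ := hS
      have hlt : ∀ B : Set V, B ≠ Set.univ → Nat.card B < n := fun B hB => by
        rw [← h, Nat.card_coe_set_eq, ← Set.ncard_univ]
        exact Set.ncard_lt_ncard (Set.ssubset_univ_iff.2 hB) (Set.toFinite _)
      refine colourable_of_induce (A := A) (by omega) (ih _ (hlt A hA') (hG.induce _) rfl)
        (ih _ (hlt Aᶜ ?_) (hG.induce _) rfl)
      rw [Ne, Set.compl_univ_iff]
      exact hA.ne_empty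

end CubicGraph

/-! ### From multigraphs to cubic graphs and back -/

lemma Far.le_abs_val_sub {a b : ZMod 11} (h : Far a b) :
    3 ≤ |(a.val : ℤ) - b.val| ∧ |(a.val : ℤ) - b.val| ≤ 8 := by
  revert a b
  decide

/-- A symmetric functional relation on darts without loops defines a cubic graph. -/
lemma CubicGraph.exists_of_relation {V : Type*} {R : V × Fin 3 → V × Fin 3 → Prop}
    (hsymm : ∀ d d', R d d' → R d' d) (hfun : ∀ d d' d'', R d d' → R d d'' → d' = d'')
    (hloop : ∀ d d', R d d' → d'.1 ≠ d.1) :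
    ∃ H : CubicGraph V, (∀ d d', R d d' → H.ι d = d') ∧ ∀ d, H.ι d = d ∨ R d (H.ι d) := by
  classical
  obtain ⟨ι, hι, hι'⟩ : ∃ ι : V × Fin 3 → V × Fin 3, (∀ d d', R d d' → ι d = d') ∧
      ∀ d, ι d = d ∨ R d (ι d) := by
    refine ⟨fun d => if h : ∃ d', R d d' then h.choose else d, fun d d' h => ?_, fun d => ?_⟩
    · have h' : ∃ d', R d d' := ⟨d', h⟩
      simp only [h', dif_pos]
      exact hfun _ _ _ h'.choose_spec h
    · by_cases h : ∃ d', R d d'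
      · simp only [h, dif_pos]
        exact Or.inr h.choose_spec
      · simp [h]
  refine ⟨⟨ι, fun d => ?_, fun d hd => ?_⟩, hι, hι'⟩
  · rcases hι' d with h | h
    · rw [h, h]
    · exact hι _ _ (hsymm _ _ h)
  · rcases hι' d with h | h
    · exact h
    · exact (hloop _ _ h hd).elim

/-- In a graph with a circular edge-colouring of ratio less than `4`, the edges at a vertex can be
indexed by `Fin 3`. -/
lemma exists_injOn_inc {α β : Type*} {G : Graph α β} (hE : G.edgeSet.Finite) {p q : ℕ}
    (hpq : p < 4 * q) {f : G.edgeSet → Fin p}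
    (hf : IsCircularColoring (multigraphLineGraph G) p q f) (v : α) :
    ∃ g : β → Fin 3, Set.InjOn g {e | G.Inc e v} := by
  have hfin : {e | G.Inc e v}.Finite := hE.subset fun e he => he.edge_mem
  have hcard : {e | G.Inc e v}.ncard ≤ 3 := by
    by_contra! h
    obtain ⟨S, hS, hS4⟩ := Set.exists_subset_card_eq (show 4 ≤ {e | G.Inc e v}.ncard from h)
    obtain ⟨a, b, c, d, ab, ac, ad, bc, bd, cd, rfl⟩ := Set.ncard_eq_four.1 hS4
    have key : ∀ x y (hx : G.Inc x v) (hy : G.Inc y v), x ≠ y →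
        CircFar p q ((f ⟨x, hx.edge_mem⟩ : ℕ) : ℤ) ((f ⟨y, hy.edge_mem⟩ : ℕ) : ℤ) :=
      fun x y hx hy hxy => hf _ _ ⟨fun h => hxy (congrArg Subtype.val h), v, hx, hy⟩
    have ia : G.Inc a v := hS (by simp)
    have ib : G.Inc b v := hS (by simp)
    have ic : G.Inc c v := hS (by simp)
    have id : G.Inc d v := hS (by simp)
    exact not_circFar_four (by exact_mod_cast hpq) (key a b ia ib ab) (key a c ia ic ac)
      (key a d ia id ad) (key b c ib ic bc) (key b d ib id bd) (key c d ic id cd)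
  have := hfin.to_subtype
  have := Fintype.ofFinite {e | G.Inc e v}
  obtain ⟨g⟩ : Nonempty ({e | G.Inc e v} ↪ Fin 3) := by
    apply Function.Embedding.nonempty_of_card_le
    rwa [Fintype.card_fin, ← Nat.card_eq_fintype_card, Nat.card_coe_set_eq]
  classical
  refine ⟨fun e => if h : G.Inc e v then g ⟨e, h⟩ else 0, fun e he e' he' h => ?_⟩
  rw [Set.mem_ofPred_eq] at he he'
  simp only [he, he', dif_pos] at h
  exact congrArg Subtype.val (g.injective h)

/-- A circular edge-colouring of ratio less than `4` can be replaced by one of ratio `11/3`. -/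
theorem exists_isCircularColoring_eleven_three {α β : Type*} (G : Graph α β) [G.Loopless]
    (hV : G.vertexSet.Finite) (hE : G.edgeSet.Finite) {p q : ℕ} (hq : 0 < q) (hqp : q ≤ p)
    (hpq : p < 4 * q) {f : G.edgeSet → Fin p}
    (hf : IsCircularColoring (multigraphLineGraph G) p q f) :
    ∃ g : G.edgeSet → Fin 11, IsCircularColoring (multigraphLineGraph G) 11 3 g := by
  classical
  choose n hn using exists_injOn_inc hE hpq hf
  have := hV.to_subtype
  -- Two darts are related when they are the ends of one edge; an index that carries no edge at its
  -- vertex will yield a semi-edge.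
  obtain ⟨R, hR⟩ : ∃ R : G.vertexSet × Fin 3 → G.vertexSet × Fin 3 → Prop, ∀ d d', R d d' ↔
      ∃ e, G.IsLink e d.1 d'.1 ∧ n d.1 e = d.2 ∧ n d'.1 e = d'.2 := ⟨fun d d' => _, fun _ _ => Iff.rfl⟩
  obtain ⟨H, hH, hH'⟩ := CubicGraph.exists_of_relation (R := R)
    (fun d d' h => by
      rw [hR] at h ⊢
      obtain ⟨e, h1, h2, h3⟩ := h
      exact ⟨e, h1.symm, h3, h2⟩)
    (fun d d' d'' h h' => by
      rw [hR] at h h'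
      obtain ⟨e, h1, h2, h3⟩ := h
      obtain ⟨e', h1', h2', h3'⟩ := h'
      obtain rfl := hn _ h1.inc_left h1'.inc_left (h2.trans h2'.symm)
      have h4 : d'.1 = d''.1 := Subtype.ext (h1.right_unique h1')
      refine Prod.ext h4 ?_
      rw [← h3, ← h3', h4])
    (fun d d' h h' => by
      rw [hR] at h
      obtain ⟨e, h1, -⟩ := h
      rw [h'] at h1
      exact G.not_isLoopAt _ _ h1)
  have hcol : H.CircColourable := by
    obtain ⟨c, hc, hc0⟩ : ∃ c : G.vertexSet × Fin 3 → ℤ, (∀ (d : G.vertexSet × Fin 3) (e : G.edgeSet),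
        G.Inc e d.1 → n d.1 e = d.2 → c d = (f e : ℕ)) ∧ ∀ d, 0 ≤ c d ∧ c d < p := by
      -- The default `0` occurs only on semi-edges, where no distance is required.
      refine ⟨fun d => if h : ∃ e : G.edgeSet, G.Inc e d.1 ∧ n d.1 e = d.2 then
        ((f h.choose : ℕ) : ℤ) else 0, fun d e h1 h2 => ?_, fun d => ?_⟩
      · have h : ∃ e : G.edgeSet, G.Inc e d.1 ∧ n d.1 e = d.2 := ⟨e, h1, h2⟩
        simp only [h, dif_pos]
        rw [Subtype.ext (hn _ h.choose_spec.1 h1 (h.choose_spec.2.trans h2.symm))]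
      · dsimp only
        split_ifs
        · exact ⟨by positivity, by exact_mod_cast Fin.is_lt _⟩
        · exact ⟨le_rfl, by omega⟩
    refine ⟨p, q, by exact_mod_cast hq, by exact_mod_cast hpq, c, hc0, fun d => ?_,
      fun v i j hij hi hj => ?_⟩
    · rcases hH' d with h | h
      · rw [h]
      · rw [hR] at h
        obtain ⟨e, h1, h2, h3⟩ := h
        rw [hc _ ⟨e, h1.edge_mem⟩ h1.inc_left h2, hc _ ⟨e, h1.edge_mem⟩ h1.inc_right h3]
    · have hi' := (hH' (v, i)).resolve_left hi
      have hj' := (hH' (v, j)).resolve_left hj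
      rw [hR] at hi' hj'
      obtain ⟨e, h1, h2, -⟩ := hi'
      obtain ⟨e', h1', h2', -⟩ := hj'
      rw [hc _ ⟨e, h1.edge_mem⟩ h1.inc_left h2, hc _ ⟨e', h1'.edge_mem⟩ h1'.inc_left h2']
      refine hf _ _ ⟨fun h => hij ?_, v, h1.inc_left, h1'.inc_left⟩
      have h3 : e = e' := congrArg Subtype.val h
      rw [← h3] at h2'
      exact h2.symm.trans h2'
  obtain ⟨c, hc, hfar⟩ := hcol.colourable
  have hend : ∀ e : G.edgeSet, ∃ v : G.vertexSet, G.Inc e v := fun e => by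
    obtain ⟨x, y, h⟩ := G.exists_isLink_of_mem_edgeSet e.2
    exact ⟨⟨x, h.left_mem⟩, h.inc_left⟩
  choose t ht using hend
  -- The colour of an edge may be read at either end.
  have hval : ∀ (e : G.edgeSet) (v : G.vertexSet), G.Inc e v →
      c (t e, n (t e) e) = c (v, n v e) := by
    intro e v hv
    obtain ⟨y, hy⟩ := ht e
    rcases hv.eq_or_eq_of_isLink hy with h | h
    · rw [Subtype.ext h]
    · rw [← h] at hy
      rw [← hc (t e, n (t e) e), hH _ (v, n v e) ((hR _ _).2 ⟨e, hy, rfl, rfl⟩)]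
  refine ⟨fun e => ⟨(c (t e, n (t e) e)).val, ZMod.val_lt _⟩, ?_⟩
  rintro e e' ⟨hne, x, hx, hx'⟩
  have hxv := hx.vertex_mem
  have := hfar ⟨x, hxv⟩ (n x e) (n x e') fun h => hne (Subtype.ext (hn _ hx hx' h))
  rw [← hval e ⟨x, hxv⟩ hx, ← hval e' ⟨x, hxv⟩ hx'] at this
  exact this.le_abs_val_sub

theorem corollary1p6 {α β : Type*} (G : Graph α β) [G.Loopless]
    (hV : G.vertexSet.Finite) (hE : G.edgeSet.Finite) :
    ¬ ((11 : ℝ) / 3 < circularChromaticIndex G ∧ circularChromaticIndex G < 4) := by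
  rintro ⟨h1, h2⟩
  unfold circularChromaticIndex circularChromaticNumber at h1 h2
  -- For an empty set the infimum would be `0`, below `11 / 3`.
  have hne : {r : ℝ | ∃ p q : ℕ, 0 < q ∧ q ≤ p ∧ (∃ f : G.edgeSet → Fin p,
      IsCircularColoring (multigraphLineGraph G) p q f) ∧ r = (p : ℝ) / (q : ℝ)}.Nonempty := by
    by_contra h
    rw [Set.not_nonempty_iff_eq_empty] at h
    rw [h, Real.sInf_empty] at h1
    norm_num at h1
  -- Whether the infimum is attained is irrelevant: any `p / q` below `4` will do.
  obtain ⟨_, ⟨p, q, hq, hqp, ⟨f, hf⟩, rfl⟩, hlt⟩ := exists_lt_of_csInf_lt hne h2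
  have hq' : (0 : ℝ) < q := by exact_mod_cast hq
  rw [div_lt_iff₀ hq'] at hlt
  obtain ⟨g, hg⟩ := exists_isCircularColoring_eleven_three G hV hE hq hqp (by exact_mod_cast hlt) hf
  refine h1.not_ge (csInf_le ⟨0, ?_⟩ ⟨11, 3, by norm_num, by norm_num, ⟨g, hg⟩, by norm_num⟩)
  rintro _ ⟨p, q, -, -, -, rfl⟩
  positivity
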